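/- Let $G_1,G_2,\dots$ be i.i.d. real random variables (the gaps) with finite variance, mean $\mu$ and variance $\sigma^2$, $\sigma>0$. Let $y_i=\sum_{j=1}^i G_j$ ($y_0=0$) be the keys. For $\varepsilon>0$ let $$i^*=\inf\{i\in\mathbb N:\ y_i>\mu i+\varepsilon\ \text{ or }\ y_i<\mu i-\varepsilon\}$$ be the number of keys covered by one linear segment with slope $a=\mu$ and margin $\varepsilon$. If $\varepsilon$ is sufficiently larger than $\sigma$, then the variance of $i^*$ is $\frac{2\varepsilon^4}{3\sigma^4}$ and its second moment is $\frac{5\varepsilon^4}{3\sigma^4}$, in the following sense. (1) Asymptotically, as $\varepsilon/\sigma\to\infty$: for every probability law $\nu$ on $\mathbb R$ and every $\delta>0$ there is $K>0$, depending only on $\nu$ and $\delta$, such that whenever the standardized gap $(G_1-\mu)/\sigma$ has law $\nu$ and $\varepsilon\ge K\sigma$, the variable $i^*$ is almost surely finite and square integrable, and $$\Bigl|\mathbb E[(i^*)^2]-\frac{5\varepsilon^4}{3\sigma^4}\Bigr|\le\delta\,\frac{\varepsilon^4}{\sigma^4},\qquad \Bigl|\operatorname{Var}(i^*)-\frac{2\varepsilon^4}{3\sigma^4}\Bigr|\le\delta\,\frac{\varepsilon^4}{\sigma^4}.$$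 (2) Exactly, in the Brownian model: if $(B_t)_{t\ge0}$ is a standard Brownian motion started at $0$, $\sigma,\varepsilon>0$ and $\tau=\inf\{t\ge0:\ \sigma B_t\notin[-\varepsilon,\varepsilon]\}$, then $\tau$ is almost surely finite and square integrable, and $$\mathbb E[\tau^2]=\frac{5\varepsilon^4}{3\sigma^4},\qquad \operatorname{Var}(\tau)=\frac{2\varepsilon^4}{3\sigma^4}.$$ -/

import Mathlib

open MeasureTheory ProbabilityTheory
open scoped NNReal ENNReal

namespace SoftFD

/-- `G 0, G 1, …` are the gaps of the soft-FD model: i.i.d. real random variables with finite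
second moment, mean `μ` and variance `σ ^ 2`. -/
structure IsGapSequence {Ω : Type*} [MeasurableSpace Ω] (P : Measure Ω)
    (G : ℕ → Ω → ℝ) (μ σ : ℝ) : Prop where
  indep : iIndepFun G P
  identDistrib : ∀ i, IdentDistrib (G i) (G 0) P P
  memLp : MemLp (G 0) 2 P
  mean : ∫ ω, G 0 ω ∂P = μ
  variance : Var[G 0; P] = σ ^ 2

/-- The keys `y_i`: the sequence started at `y_0 = 0` whose increments are the gaps. -/
def key {Ω : Type*} (G : ℕ → Ω → ℝ) (i : ℕ) (ω : Ω) : ℝ :=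
  ∑ j ∈ Finset.range i, G j ω

/-- The number of keys covered by the segment of slope `a` through the origin with margin `ε`:
the first index `i` with `y_i > a * i + ε` or `y_i < a * i - ε`
(`⊤` if the sequence never leaves the strip). -/
noncomputable def keysCovered {Ω : Type*} (y : ℕ → Ω → ℝ) (a ε : ℝ) (ω : Ω) : ℕ∞ :=
  ⨅ (i : ℕ) (_ : y i ω > a * i + ε ∨ y i ω < a * i - ε), (i : ℕ∞)

/-- First exit time of the real process `X` from `[-ε, ε]` (`⊤` if it never exits). -/
noncomputable def exitTime {Ω : Type*} (X : ℝ≥0 → Ω → ℝ) (ε : ℝ) (ω : Ω) : ℝ≥0∞ :=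
  ⨅ (t : ℝ≥0) (_ : X t ω ∉ Set.Icc (-ε) ε), (t : ℝ≥0∞)

end SoftFD

/-! After standardizing the gaps, `i*` is the exit index of a centred, unit-variance walk from `[-r,
r]`, where `r = ε / σ`. Let `Y` be the walk frozen at exit and `T` its number of steps. The
martingale `Y² - T` gives `E T = E Y² ≈ r²`. The heat polynomial `Y⁴ - 6 T Y² + 3 T²` is nearly a
martingale; with `|Y| ≈ r` at exit it gives `r⁴ - 6 r² · r² + 3 E T² ≈ 0`. So `E T² ≈ 5 r⁴ / 3`, and
the variance is about `(5/3 - 1) r⁴`.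

Only two moments are available, so `E Y⁴` may be infinite. The fourth power is therefore capped at
`(2 r)⁴`, and each step is split by size at level `κ r`: small steps have a small Taylor remainder,
and large ones are paid for by the tail `ψ = E[X²; |X| > κ r]` (`abs_cappedQuartic_taylor_le`,
`IsStandardSteps.abs_integral_spaceTime_le`). The overshoot `D` is treated the same way: `D² ≤ c²`
plus the tails of the steps made, whose expectation is `ψ(c) E T` by Wald. For fixed `κ` and large
`r`, `ψ ≤ κ³`, and every error is `O(κ r⁴)` up to survival terms. These vanish as time grows,
because they are increments of bounded monotone sequences (`IsStandardSteps.exists_limit_moments`).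

For Brownian motion, sample `σ B` on the grid of mesh `2⁻ⁿ`. The standardized gaps are standard
Gaussian for every `n`, so one threshold `K` serves all grids, and the ratio of margin to gap
deviation tends to infinity. By path continuity the grid exit times decrease to `τ`; dominated
convergence then turns the asymptotic values into exact ones. -/

namespace SoftFD

open Filter
open scoped Topology

/-! ### The frozen walk: pathwise bounds on overshoot and capped fourth power. -/

section StoppedWalk

variable {Ω : Type*}

/-- `X 0, X 1, …` are measurable i.i.d. steps with common law `ν` of mean `0` and variance `1`. -/
structure IsStandardSteps [MeasurableSpace Ω] (P : Measure Ω) (X : ℕ → Ω → ℝ)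
    (ν : Measure ℝ) : Prop where
  meas : ∀ i, Measurable (X i)
  indep : iIndepFun X P
  law : ∀ i, P.map (X i) = ν
  integrable_sq : Integrable (fun x : ℝ => x ^ 2) ν
  mean : ∫ x, x ∂ν = 0
  second : ∫ x, x ^ 2 ∂ν = 1

/-- The random walk with steps `X`, frozen from the moment it leaves `[-r, r]`. -/
noncomputable def stoppedWalk (X : ℕ → Ω → ℝ) (r : ℝ) : ℕ → Ω → ℝ
  | 0 => fun _ => 0
  | n + 1 => fun ω => stoppedWalk X r n ω + (if |stoppedWalk X r n ω| ≤ r then 1 else 0) * X n ω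

/-- Indicator of the event that the stopped walk is still inside `[-r, r]` at time `n`. -/
noncomputable def inside (X : ℕ → Ω → ℝ) (r : ℝ) (n : ℕ) (ω : Ω) : ℝ :=
  if |stoppedWalk X r n ω| ≤ r then 1 else 0

/-- The number of steps made before time `n` by the stopped walk. -/
noncomputable def stepCount (X : ℕ → Ω → ℝ) (r : ℝ) (n : ℕ) (ω : Ω) : ℝ :=
  ∑ k ∈ Finset.range n, inside X r k ω

/-- The sigma-algebra generated by the first `n` steps. -/
@[reducible] def past (X : ℕ → Ω → ℝ) (n : ℕ) : MeasurableSpace Ω :=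
  ⨆ i ∈ Set.Iio n, MeasurableSpace.comap (X i) inferInstance

/-- The square, restricted to arguments of absolute value greater than `c`. -/
noncomputable def tailSq (c x : ℝ) : ℝ := if c < |x| then x ^ 2 else 0

/-- The sum of the tails of the squared steps made before time `n`. -/
noncomputable def tailSum (X : ℕ → Ω → ℝ) (r c : ℝ) (n : ℕ) (ω : Ω) : ℝ :=
  ∑ k ∈ Finset.range n, inside X r k ω * tailSq c (X k ω)

/-- The sum of the tails of the squared steps made before time `n`, weighted by time. -/
noncomputable def weightedTailSum (X : ℕ → Ω → ℝ) (r c : ℝ) (n : ℕ) (ω : Ω) : ℝ :=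
  ∑ k ∈ Finset.range n, (inside X r k ω * (stepCount X r k ω + 1)) * tailSq c (X k ω)

/-- Distance of the stopped walk to `[-r, r]`. -/
noncomputable def overshoot (X : ℕ → Ω → ℝ) (r : ℝ) (n : ℕ) (ω : Ω) : ℝ :=
  max (|stoppedWalk X r n ω| - r) 0

/-- The fourth power, capped at `16 * r ^ 4`. -/
noncomputable def cappedQuartic (r x : ℝ) : ℝ := min (x ^ 4) (16 * r ^ 4)

variable {X : ℕ → Ω → ℝ} {r c κ : ℝ} {n : ℕ} {ω : Ω}

/-! ### Pathwise facts -/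

lemma stoppedWalk_succ :
    stoppedWalk X r (n + 1) ω = stoppedWalk X r n ω + inside X r n ω * X n ω := rfl

lemma stepCount_succ : stepCount X r (n + 1) ω = stepCount X r n ω + inside X r n ω := by
  simp [stepCount, Finset.sum_range_succ]

lemma inside_nonneg : 0 ≤ inside X r n ω := by
  unfold inside; split_ifs <;> norm_num

lemma inside_le_one : inside X r n ω ≤ 1 := by
  unfold inside; split_ifs <;> norm_num

lemma inside_mul_self : inside X r n ω * inside X r n ω = inside X r n ω := by
  unfold inside; split_ifs <;> norm_num

lemma inside_cases :
    (inside X r n ω = 1 ∧ |stoppedWalk X r n ω| ≤ r) ∨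
      (inside X r n ω = 0 ∧ r < |stoppedWalk X r n ω|) := by
  unfold inside; split_ifs with h
  · exact Or.inl ⟨rfl, h⟩
  · exact Or.inr ⟨rfl, not_le.1 h⟩

lemma stepCount_nonneg : 0 ≤ stepCount X r n ω :=
  Finset.sum_nonneg fun _ _ => inside_nonneg

lemma stepCount_le : stepCount X r n ω ≤ n := by
  simpa [stepCount] using Finset.sum_le_sum (s := Finset.range n)
    (fun k _ => inside_le_one (X := X) (r := r) (n := k) (ω := ω))

lemma stepCount_mono : Monotone fun n => stepCount X r n ω :=
  monotone_nat_of_le_succ fun n => by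
    rw [stepCount_succ]; linarith [inside_nonneg (X := X) (r := r) (n := n) (ω := ω)]

lemma tailSq_nonneg (c x : ℝ) : 0 ≤ tailSq c x := by
  unfold tailSq; split_ifs <;> positivity

lemma tailSq_le (c x : ℝ) : tailSq c x ≤ x ^ 2 := by
  unfold tailSq; split_ifs
  · exact le_rfl
  · positivity

lemma sq_le_add_tailSq (c x : ℝ) : x ^ 2 ≤ c ^ 2 + tailSq c x := by
  unfold tailSq; split_ifs with h
  · nlinarith [sq_nonneg c]
  · rw [← sq_abs x]; nlinarith [abs_nonneg x]

lemma overshoot_nonneg : 0 ≤ overshoot X r n ω := le_max_right _ _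

lemma overshoot_succ_of_inside (h : |stoppedWalk X r n ω| ≤ r) (hi : inside X r n ω = 1) :
    overshoot X r (n + 1) ω ≤ |X n ω| := by
  unfold overshoot
  rw [stoppedWalk_succ, hi, one_mul]
  refine max_le ?_ (abs_nonneg _)
  linarith [abs_add_le (stoppedWalk X r n ω) (X n ω)]

/-- Only one step can lead outside, and the overshoot is at most its length. The square of that step
is at most `c ^ 2` plus its own tail; all other tails are nonnegative. -/
lemma overshoot_sq_le (hr : 0 ≤ r) :
    overshoot X r n ω ^ 2 ≤ c ^ 2 + tailSum X r c n ω := by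
  induction n with
  | zero => simp [overshoot, stoppedWalk, tailSum, hr]; positivity
  | succ n ih =>
    have hs : tailSum X r c (n + 1) ω = tailSum X r c n ω + inside X r n ω * tailSq c (X n ω) := by
      simp [tailSum, Finset.sum_range_succ]
    have h0 : 0 ≤ tailSum X r c n ω :=
      Finset.sum_nonneg fun _ _ => mul_nonneg inside_nonneg (tailSq_nonneg _ _)
    rw [hs]
    rcases inside_cases (X := X) (r := r) (n := n) (ω := ω) with ⟨h1, h2⟩ | ⟨h1, h2⟩
    · have h3 := overshoot_succ_of_inside h2 h1
      have h4 : overshoot X r (n + 1) ω ^ 2 ≤ X n ω ^ 2 := by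
        rw [← sq_abs (X n ω)]; exact pow_le_pow_left₀ overshoot_nonneg h3 2
      rw [h1]; linarith [sq_le_add_tailSq c (X n ω)]
    · have : overshoot X r (n + 1) ω = overshoot X r n ω := by
        simp [overshoot, stoppedWalk_succ, h1]
      rw [this, h1]; linarith

/-- The same argument with time as weight: when step `n` causes the exit, the count freezes at its
previous value plus one, hence the weight in `weightedTailSum`. -/
lemma stepCount_mul_overshoot_sq_le :
    stepCount X r n ω * overshoot X r n ω ^ 2 ≤
      c ^ 2 * stepCount X r n ω + weightedTailSum X r c n ω := by
  induction n with
  | zero => simp [stepCount, weightedTailSum]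
  | succ n ih =>
    have hs : weightedTailSum X r c (n + 1) ω = weightedTailSum X r c n ω +
        (inside X r n ω * (stepCount X r n ω + 1)) * tailSq c (X n ω) := by
      simp [weightedTailSum, Finset.sum_range_succ]
    have h0 : 0 ≤ weightedTailSum X r c n ω :=
      Finset.sum_nonneg fun _ _ => mul_nonneg (mul_nonneg inside_nonneg
        (add_nonneg stepCount_nonneg zero_le_one)) (tailSq_nonneg _ _)
    have hT := stepCount_nonneg (X := X) (r := r) (n := n) (ω := ω)
    rw [hs, stepCount_succ]
    rcases inside_cases (X := X) (r := r) (n := n) (ω := ω) with ⟨h1, h2⟩ | ⟨h1, h2⟩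
    · have h3 := overshoot_succ_of_inside h2 h1
      have h4 : overshoot X r (n + 1) ω ^ 2 ≤ X n ω ^ 2 := by
        rw [← sq_abs (X n ω)]; exact pow_le_pow_left₀ overshoot_nonneg h3 2
      have h5 := h4.trans (sq_le_add_tailSq c (X n ω))
      rw [h1]
      have := mul_le_mul_of_nonneg_left h5 (by linarith : 0 ≤ stepCount X r n ω + 1)
      linarith
    · have : overshoot X r (n + 1) ω = overshoot X r n ω := by
        simp [overshoot, stoppedWalk_succ, h1]
      rw [this, h1]; linarith

lemma abs_stoppedWalk_le : |stoppedWalk X r n ω| ≤ r + overshoot X r n ω := by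
  unfold overshoot; linarith [le_max_left (|stoppedWalk X r n ω| - r) 0]

/-- Young's inequality `2 r D ≤ κ r² + D² / κ` for the cross term of `(r + D)²`. -/
lemma sq_stoppedWalk_le (hκ : 0 < κ) :
    stoppedWalk X r n ω ^ 2 ≤ (1 + κ) * r ^ 2 + (1 + 1 / κ) * overshoot X r n ω ^ 2 := by
  set D := overshoot X r n ω
  have h1 : stoppedWalk X r n ω ^ 2 ≤ (r + D) ^ 2 := by
    rw [← sq_abs]; exact pow_le_pow_left₀ (abs_nonneg _) abs_stoppedWalk_le 2
  have h2 : 0 ≤ (κ * r - D) ^ 2 / κ := by positivity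
  have h3 : (κ * r - D) ^ 2 / κ = κ * r ^ 2 - 2 * r * D + 1 / κ * D ^ 2 := by
    field_simp; ring
  nlinarith

lemma le_sq_stoppedWalk (hr : 0 ≤ r) :
    r ^ 2 - r ^ 2 * inside X r n ω ≤ stoppedWalk X r n ω ^ 2 := by
  rcases inside_cases (X := X) (r := r) (n := n) (ω := ω) with ⟨h1, h2⟩ | ⟨h1, h2⟩
  · rw [h1]; nlinarith [sq_nonneg (stoppedWalk X r n ω)]
  · rw [h1, ← sq_abs (stoppedWalk X r n ω)]; nlinarith

lemma cappedQuartic_nonneg (r x : ℝ) : 0 ≤ cappedQuartic r x :=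
  le_min (by positivity) (by positivity)

lemma cappedQuartic_le (r x : ℝ) : cappedQuartic r x ≤ 16 * r ^ 4 := min_le_right _ _

lemma cappedQuartic_eq {x : ℝ} (h : |x| ≤ 2 * r) : cappedQuartic r x = x ^ 4 := by
  refine min_eq_left ?_
  have : |x| ^ 4 ≤ (2 * r) ^ 4 := pow_le_pow_left₀ (abs_nonneg _) h 4
  have h2 : |x| ^ 4 = x ^ 4 := by rw [← abs_pow]; exact abs_of_nonneg (by positivity)
  nlinarith

lemma le_cappedQuartic_stoppedWalk (hr : 0 ≤ r) :
    r ^ 4 - r ^ 4 * inside X r n ω ≤ cappedQuartic r (stoppedWalk X r n ω) := by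
  rcases inside_cases (X := X) (r := r) (n := n) (ω := ω) with ⟨h1, h2⟩ | ⟨h1, h2⟩
  · rw [h1]; linarith [cappedQuartic_nonneg r (stoppedWalk X r n ω)]
  · rw [h1]
    have h3 : r ^ 4 ≤ |stoppedWalk X r n ω| ^ 4 := pow_le_pow_left₀ hr h2.le 4
    have h4 : |stoppedWalk X r n ω| ^ 4 = stoppedWalk X r n ω ^ 4 := by
      rw [← abs_pow]; exact abs_of_nonneg (by positivity)
    have : (0:ℝ) ≤ r ^ 4 := by positivity
    refine le_trans ?_ (le_min (h3.trans_eq h4) (by linarith : r ^ 4 ≤ 16 * r ^ 4))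
    linarith

/-- For `D ≤ r`, the terms of `(r + D)⁴ - r⁴` have coefficients `4 + 6 + 4 + 1 = 15`, each power
product being at most `r³ D`. For `D ≥ r` the cap `16 r⁴` is enough. -/
lemma cappedQuartic_stoppedWalk_le (hr : 0 ≤ r) :
    cappedQuartic r (stoppedWalk X r n ω) ≤ r ^ 4 + 15 * r ^ 3 * overshoot X r n ω := by
  set D := overshoot X r n ω
  have hD : 0 ≤ D := overshoot_nonneg
  have h3 : (0:ℝ) ≤ r ^ 3 := by positivity
  rcases le_total D r with h | h
  · refine (min_le_left _ _).trans ?_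
    have h4 : |stoppedWalk X r n ω| ^ 4 = stoppedWalk X r n ω ^ 4 := by
      rw [← abs_pow]; exact abs_of_nonneg (by positivity)
    have h5 : |stoppedWalk X r n ω| ^ 4 ≤ (r + D) ^ 4 :=
      pow_le_pow_left₀ (abs_nonneg _) abs_stoppedWalk_le 4
    have e1 : D ^ 2 ≤ r * D := by nlinarith
    have e2 : r ^ 2 * D ^ 2 ≤ r ^ 3 * D := by nlinarith [sq_nonneg r]
    have e3 : r * D ^ 3 ≤ r ^ 3 * D := by
      have : r * D * D ^ 2 ≤ r * D * (r * D) := mul_le_mul_of_nonneg_left e1 (by positivity)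
      nlinarith
    have e4 : D ^ 4 ≤ r ^ 3 * D := by
      have : D ^ 2 * D ^ 2 ≤ (r * D) * (r * D) := mul_le_mul e1 e1 (by positivity) (by positivity)
      nlinarith
    nlinarith
  · refine (min_le_right _ _).trans ?_
    nlinarith

/-- A step of size at most `κ r` stays below the cap, and the exact remainder is `(4 y x + x²) x²`.
For a larger step each term is bounded separately by a multiple of `r² (x / κ)²`; the constant is
`27 = 16 + 1 + 4 + 6`. -/
lemma abs_cappedQuartic_taylor_le {y x : ℝ} (hr : 0 < r) (hκ : 0 < κ) (hκ1 : κ ≤ 1)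
    (hy : |y| ≤ r) :
    |cappedQuartic r (y + x) - y ^ 4 - 4 * y ^ 3 * x - 6 * y ^ 2 * x ^ 2| ≤
      5 * κ * r ^ 2 * x ^ 2 + 27 / κ ^ 2 * r ^ 2 * tailSq (κ * r) x := by
  unfold tailSq
  split_ifs with h
  · set a := |x| with ha
    have hx2 : x ^ 2 = a ^ 2 := (sq_abs x).symm
    -- A large step means `b > r`, so every monomial of degree four is bounded by `r² b²`.
    set b := a / κ with hb
    have hab : a = κ * b := by rw [hb]; field_simp
    have hb0 : r ≤ b := by rw [hab] at h; nlinarith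
    have hab' : a ≤ b := by rw [hab]; nlinarith
    have ha0 : 0 ≤ a := abs_nonneg x
    have e0 : 27 / κ ^ 2 * r ^ 2 * x ^ 2 = 27 * r ^ 2 * b ^ 2 := by
      rw [hx2, hb]; field_simp
    have y2 : y ^ 2 ≤ r ^ 2 := by rw [← sq_abs]; exact pow_le_pow_left₀ (abs_nonneg _) hy 2
    have hrb : r ^ 2 ≤ b ^ 2 := pow_le_pow_left₀ hr.le hb0 2
    have hab2 : a ^ 2 ≤ b ^ 2 := pow_le_pow_left₀ ha0 hab' 2
    have y4 : y ^ 4 ≤ r ^ 2 * b ^ 2 := by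
      have : y ^ 2 * y ^ 2 ≤ r ^ 2 * b ^ 2 :=
        mul_le_mul y2 (y2.trans hrb) (by positivity) (by positivity)
      nlinarith
    have r4 : r ^ 4 ≤ r ^ 2 * b ^ 2 := by
      have : r ^ 2 * r ^ 2 ≤ r ^ 2 * b ^ 2 := mul_le_mul_of_nonneg_left hrb (by positivity)
      nlinarith
    have yx : |y ^ 3 * x| ≤ r ^ 2 * b ^ 2 := by
      rw [abs_mul, abs_pow]
      have h3 : |y| ^ 3 ≤ r ^ 3 := pow_le_pow_left₀ (abs_nonneg _) hy 3
      calc |y| ^ 3 * |x| ≤ r ^ 3 * b := mul_le_mul h3 hab' (abs_nonneg _) (by positivity)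
        _ = r ^ 2 * (r * b) := by ring
        _ ≤ r ^ 2 * (b * b) := by gcongr
        _ = _ := by ring
    have y2x2 : y ^ 2 * x ^ 2 ≤ r ^ 2 * b ^ 2 := by
      rw [hx2]; exact mul_le_mul y2 hab2 (by positivity) (by positivity)
    have q0 := cappedQuartic_nonneg r (y + x)
    have q1 := cappedQuartic_le r (y + x)
    rw [e0]
    have p1 : 0 ≤ 5 * κ * r ^ 2 * x ^ 2 := by positivity
    have p2 : 0 ≤ y ^ 4 := by positivity
    have p3 : 0 ≤ y ^ 2 * x ^ 2 := by positivity
    have p4 : 0 ≤ r ^ 2 * b ^ 2 := by positivity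
    obtain ⟨yx1, yx2⟩ := abs_le.1 yx
    rw [abs_le]
    constructor <;> linarith
  · have h' := not_lt.1 h
    have hs : |y + x| ≤ 2 * r := by
      have : κ * r ≤ r := by nlinarith
      linarith [abs_add_le y x]
    rw [cappedQuartic_eq hs]
    have e : (y + x) ^ 4 - y ^ 4 - 4 * y ^ 3 * x - 6 * y ^ 2 * x ^ 2 =
        (4 * (y * x) + x ^ 2) * x ^ 2 := by ring
    rw [e, abs_mul, abs_of_nonneg (sq_nonneg x), mul_zero, add_zero]
    refine mul_le_mul_of_nonneg_right ?_ (sq_nonneg x)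
    have h1 : |y * x| ≤ r * (κ * r) := by
      rw [abs_mul]; exact mul_le_mul hy h' (abs_nonneg _) hr.le
    have h2 : x ^ 2 ≤ (κ * r) ^ 2 := by
      rw [← sq_abs]; exact pow_le_pow_left₀ (abs_nonneg _) h' 2
    have h3 : (κ * r) ^ 2 ≤ κ * r ^ 2 := by
      have : 0 ≤ κ * r ^ 2 := by positivity
      nlinarith
    obtain ⟨a1, a2⟩ := abs_le.1 h1
    have := sq_nonneg x
    rw [abs_le]
    constructor <;> nlinarith

end StoppedWalk

/-! ### Independence of the past and (approximate) martingale identities. -/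

section Expectations

variable {Ω : Type*} [mΩ : MeasurableSpace Ω] {P : Measure Ω} [IsProbabilityMeasure P]
  {X : ℕ → Ω → ℝ} {ν : Measure ℝ} {r c κ : ℝ} {n : ℕ}

lemma measurable_tailSq (c : ℝ) : Measurable (tailSq c) :=
  Measurable.ite (measurableSet_lt measurable_const measurable_abs) (by fun_prop) (by fun_prop)

lemma measurable_cappedQuartic (r : ℝ) : Measurable (cappedQuartic r) := by
  unfold cappedQuartic; fun_prop

omit mΩ in
lemma past_mono : Monotone (past X) := fun _ _ h =>
  biSup_mono fun _ hi => lt_of_lt_of_le hi h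

omit mΩ in
lemma measurable_past_step : Measurable[past X (n + 1)] (X n) :=
  (comap_measurable (X n)).mono
    (le_iSup₂ (f := fun i (_ : i ∈ Set.Iio (n + 1)) => MeasurableSpace.comap (X i) inferInstance)
      n (Nat.lt_succ_self n)) le_rfl

omit mΩ in
lemma measurable_inside_of_stoppedWalk {m : MeasurableSpace Ω}
    (h : Measurable[m] (stoppedWalk X r n)) : Measurable[m] (inside X r n) :=
  Measurable.ite (measurableSet_le (measurable_abs.comp h) measurable_const)
    measurable_const measurable_const

omit mΩ in
lemma measurable_past_stoppedWalk : Measurable[past X n] (stoppedWalk X r n) := by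
  induction n with
  | zero => exact measurable_const
  | succ n ih =>
    have h := ih.mono (past_mono n.le_succ) le_rfl
    exact h.add ((measurable_inside_of_stoppedWalk h).mul measurable_past_step)

omit mΩ in
lemma measurable_past_inside : Measurable[past X n] (inside X r n) :=
  measurable_inside_of_stoppedWalk measurable_past_stoppedWalk

omit mΩ in
lemma measurable_past_stepCount : Measurable[past X n] (stepCount X r n) :=
  Finset.measurable_fun_sum _ fun _ hk =>
    measurable_past_inside.mono (past_mono (Finset.mem_range.1 hk).le) le_rfl

namespace IsStandardSteps

omit [IsProbabilityMeasure P] in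
lemma past_le (hX : IsStandardSteps P X ν) (n : ℕ) : past X n ≤ mΩ :=
  iSup₂_le fun i _ => (hX.meas i).comap_le

omit [IsProbabilityMeasure P] in
lemma measurable_stoppedWalk (hX : IsStandardSteps P X ν) : Measurable (stoppedWalk X r n) :=
  measurable_past_stoppedWalk.mono (hX.past_le n) le_rfl

omit [IsProbabilityMeasure P] in
lemma measurable_inside (hX : IsStandardSteps P X ν) : Measurable (inside X r n) :=
  measurable_past_inside.mono (hX.past_le n) le_rfl

omit [IsProbabilityMeasure P] in
lemma measurable_stepCount (hX : IsStandardSteps P X ν) : Measurable (stepCount X r n) :=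
  measurable_past_stepCount.mono (hX.past_le n) le_rfl

omit [IsProbabilityMeasure P] in
lemma measurable_overshoot (hX : IsStandardSteps P X ν) : Measurable (overshoot X r n) := by
  have := hX.measurable_stoppedWalk (r := r) (n := n)
  unfold overshoot; fun_prop

omit [IsProbabilityMeasure P] in
-- The index sets `Iio n` and `{n}` are disjoint, so the sigma-algebras generated by these steps are
-- independent.
lemma indepFun_past (hX : IsStandardSteps P X ν) {g : Ω → ℝ} (hg : Measurable[past X n] g) :
    IndepFun g (X n) P := by
  have h := indep_iSup_of_disjoint (fun i => (hX.meas i).comap_le) hX.indep.iIndep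
    (S := Set.Iio n) (T := {n}) (by simp)
  rw [IndepFun_iff_Indep]
  refine indep_of_indep_of_le_left (indep_of_indep_of_le_right h ?_) hg.comap_le
  simp

lemma isProbabilityMeasure (hX : IsStandardSteps P X ν) : IsProbabilityMeasure ν := by
  rw [← hX.law 0]; exact Measure.isProbabilityMeasure_map (hX.meas 0).aemeasurable

omit [IsProbabilityMeasure P] in
lemma integrable_comp (hX : IsStandardSteps P X ν) {φ : ℝ → ℝ} (hφ : Integrable φ ν) :
    Integrable (fun ω => φ (X n ω)) P := by
  rw [← hX.law n] at hφ; exact hφ.comp_measurable (hX.meas n)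

omit [IsProbabilityMeasure P] in
lemma integrable_past_mul (hX : IsStandardSteps P X ν) {g : Ω → ℝ} {φ : ℝ → ℝ}
    (hg : Measurable[past X n] g) (hgi : Integrable g P) (hφ : Measurable φ)
    (hφi : Integrable φ ν) : Integrable (fun ω => g ω * φ (X n ω)) P :=
  ((hX.indepFun_past hg).comp measurable_id hφ).integrable_mul hgi (hX.integrable_comp hφi)

omit [IsProbabilityMeasure P] in
-- This factorization plays the role of conditioning on the past in every martingale computation
-- below.
lemma integral_past_mul (hX : IsStandardSteps P X ν) {g : Ω → ℝ} {φ : ℝ → ℝ}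
    (hg : Measurable[past X n] g) (hφ : Measurable φ) :
    ∫ ω, g ω * φ (X n ω) ∂P = (∫ ω, g ω ∂P) * ∫ x, φ x ∂ν := by
  rw [← hX.law n, integral_map (hX.meas n).aemeasurable hφ.aestronglyMeasurable]
  exact ((hX.indepFun_past hg).comp measurable_id hφ).integral_fun_mul_eq_mul_integral
    (hg.mono (hX.past_le n) le_rfl).aestronglyMeasurable
    (hφ.comp (hX.meas n)).aestronglyMeasurable

lemma integrable_id (hX : IsStandardSteps P X ν) : Integrable (fun x : ℝ => x) ν := by
  have := hX.isProbabilityMeasure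
  refine ((integrable_const (1 : ℝ)).add hX.integrable_sq).mono'
    measurable_id.aestronglyMeasurable (ae_of_all _ fun x => ?_)
  simp only [Real.norm_eq_abs, Pi.add_apply]
  rw [← sq_abs]; nlinarith [sq_nonneg (|x| - 1)]

omit [IsProbabilityMeasure P] in
lemma integrable_tailSq (hX : IsStandardSteps P X ν) : Integrable (tailSq c) ν :=
  hX.integrable_sq.mono' (measurable_tailSq c).aestronglyMeasurable (ae_of_all _ fun x => by
    rw [Real.norm_of_nonneg (tailSq_nonneg _ _)]; exact tailSq_le _ _)

lemma integrable_of_bound (_hX : IsStandardSteps P X ν) {g : Ω → ℝ} (hg : Measurable g) (C : ℝ)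
    (h : ∀ ω, |g ω| ≤ C) : Integrable g P :=
  Integrable.of_bound hg.aestronglyMeasurable C (ae_of_all _ h)

lemma integrable_inside (hX : IsStandardSteps P X ν) : Integrable (inside X r n) P :=
  hX.integrable_of_bound hX.measurable_inside 1 fun ω => by
    rw [abs_of_nonneg inside_nonneg]; exact inside_le_one

omit mΩ in
lemma abs_stepCount_pow_le (k : ℕ) (ω : Ω) : |stepCount X r n ω ^ k| ≤ (n : ℝ) ^ k := by
  rw [abs_of_nonneg (pow_nonneg stepCount_nonneg k)]
  exact pow_le_pow_left₀ stepCount_nonneg stepCount_le k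

lemma integrable_stepCount (hX : IsStandardSteps P X ν) : Integrable (stepCount X r n) P :=
  hX.integrable_of_bound hX.measurable_stepCount n fun ω => by
    rw [abs_of_nonneg stepCount_nonneg]; exact stepCount_le

lemma integrable_stepCount_sq (hX : IsStandardSteps P X ν) :
    Integrable (fun ω => stepCount X r n ω ^ 2) P :=
  hX.integrable_of_bound (hX.measurable_stepCount.pow_const 2) _
    (abs_stepCount_pow_le 2)

omit mΩ in
lemma abs_inside_mul_pow_le (hr : 0 ≤ r) (k : ℕ) (ω : Ω) :
    |inside X r n ω * stoppedWalk X r n ω ^ k| ≤ r ^ k := by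
  rcases inside_cases (X := X) (r := r) (n := n) (ω := ω) with ⟨h1, h2⟩ | ⟨h1, h2⟩
  · rw [h1, one_mul, abs_pow]; exact pow_le_pow_left₀ (abs_nonneg _) h2 k
  · rw [h1, zero_mul, abs_zero]; positivity

lemma integrable_inside_mul_pow (hX : IsStandardSteps P X ν) (hr : 0 ≤ r) (k : ℕ) :
    Integrable (fun ω => inside X r n ω * stoppedWalk X r n ω ^ k) P :=
  hX.integrable_of_bound (hX.measurable_inside.mul (hX.measurable_stoppedWalk.pow_const k)) _
    (abs_inside_mul_pow_le hr k)

omit [IsProbabilityMeasure P] in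
lemma integrable_stepCount_mul (hX : IsStandardSteps P X ν) {g : Ω → ℝ} (hg : Integrable g P) :
    Integrable (fun ω => stepCount X r n ω * g ω) P :=
  hg.bdd_mul (c := (n : ℝ)) hX.measurable_stepCount.aestronglyMeasurable (ae_of_all _ fun ω => by
    rw [Real.norm_of_nonneg stepCount_nonneg]; exact stepCount_le)

lemma integrable_inside_stepCount (hX : IsStandardSteps P X ν) :
    Integrable (fun ω => stepCount X r n ω * inside X r n ω) P :=
  hX.integrable_stepCount_mul hX.integrable_inside

omit mΩ in
lemma stoppedWalk_succ_sq (ω : Ω) : stoppedWalk X r (n + 1) ω ^ 2 =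
    stoppedWalk X r n ω ^ 2 + 2 * (inside X r n ω * stoppedWalk X r n ω ^ 1 * X n ω) +
      inside X r n ω * X n ω ^ 2 := by
  rw [stoppedWalk_succ]
  linear_combination X n ω ^ 2 * inside_mul_self (X := X) (r := r) (n := n) (ω := ω)

lemma integrable_inside_mul_step (hX : IsStandardSteps P X ν) (hr : 0 ≤ r) (k : ℕ) :
    Integrable (fun ω => inside X r n ω * stoppedWalk X r n ω ^ k * X n ω) P :=
  hX.integrable_past_mul (φ := fun x => x)
    (measurable_past_inside.mul (measurable_past_stoppedWalk.pow_const k))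
    (hX.integrable_inside_mul_pow hr k) measurable_id hX.integrable_id

omit [IsProbabilityMeasure P] in
lemma integral_inside_mul_step (hX : IsStandardSteps P X ν) (k : ℕ) :
    ∫ ω, inside X r n ω * stoppedWalk X r n ω ^ k * X n ω ∂P = 0 := by
  rw [hX.integral_past_mul (g := fun ω => inside X r n ω * stoppedWalk X r n ω ^ k)
    (φ := fun x => x) (measurable_past_inside.mul (measurable_past_stoppedWalk.pow_const k)) measurable_id,
    hX.mean, mul_zero]

lemma integrable_inside_mul_step_sq (hX : IsStandardSteps P X ν) (hr : 0 ≤ r) (k : ℕ) :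
    Integrable (fun ω => inside X r n ω * stoppedWalk X r n ω ^ k * X n ω ^ 2) P :=
  hX.integrable_past_mul (φ := fun x => x ^ 2)
    (measurable_past_inside.mul (measurable_past_stoppedWalk.pow_const k))
    (hX.integrable_inside_mul_pow hr k) (by fun_prop) hX.integrable_sq

omit [IsProbabilityMeasure P] in
lemma integral_inside_mul_step_sq (hX : IsStandardSteps P X ν) (k : ℕ) :
    ∫ ω, inside X r n ω * stoppedWalk X r n ω ^ k * X n ω ^ 2 ∂P =
      ∫ ω, inside X r n ω * stoppedWalk X r n ω ^ k ∂P := by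
  rw [hX.integral_past_mul (g := fun ω => inside X r n ω * stoppedWalk X r n ω ^ k)
    (φ := fun x => x ^ 2) (measurable_past_inside.mul (measurable_past_stoppedWalk.pow_const k))
    (by fun_prop),
    hX.second, mul_one]

lemma integrable_stoppedWalk_sq (hX : IsStandardSteps P X ν) (hr : 0 ≤ r) :
    Integrable (fun ω => stoppedWalk X r n ω ^ 2) P := by
  induction n with
  | zero => simp [stoppedWalk]
  | succ n ih =>
    simp_rw [stoppedWalk_succ_sq]
    have h := hX.integrable_inside_mul_step_sq (n := n) hr 0
    simp only [pow_zero, mul_one] at h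
    exact (ih.add ((hX.integrable_inside_mul_step hr 1).const_mul 2)).add h

lemma integral_stepCount_succ (hX : IsStandardSteps P X ν) :
    ∫ ω, stepCount X r (n + 1) ω ∂P = ∫ ω, stepCount X r n ω ∂P + ∫ ω, inside X r n ω ∂P := by
  simp_rw [stepCount_succ]
  exact integral_add hX.integrable_stepCount hX.integrable_inside

lemma integral_stepCount_sq_succ (hX : IsStandardSteps P X ν) :
    ∫ ω, stepCount X r (n + 1) ω ^ 2 ∂P = ∫ ω, stepCount X r n ω ^ 2 ∂P +
      2 * ∫ ω, stepCount X r n ω * inside X r n ω ∂P + ∫ ω, inside X r n ω ∂P := by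
  have h : ∀ ω, stepCount X r (n + 1) ω ^ 2 = stepCount X r n ω ^ 2 +
      2 * (stepCount X r n ω * inside X r n ω) + inside X r n ω := fun ω => by
    rw [stepCount_succ]
    linear_combination inside_mul_self (X := X) (r := r) (n := n) (ω := ω)
  simp_rw [h]
  have h1 := hX.integrable_stepCount_sq (r := r) (n := n)
  have h2 := (hX.integrable_inside_stepCount (r := r) (n := n)).const_mul 2
  rw [integral_add ?_ hX.integrable_inside, integral_add h1 h2, integral_const_mul]
  exact h1.add h2

/-- Wald's second identity for the stopped walk. -/
lemma integral_stoppedWalk_sq (hX : IsStandardSteps P X ν) (hr : 0 ≤ r) :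
    ∫ ω, stoppedWalk X r n ω ^ 2 ∂P = ∫ ω, stepCount X r n ω ∂P := by
  induction n with
  | zero => simp [stoppedWalk, stepCount]
  | succ n ih =>
    simp_rw [stoppedWalk_succ_sq]
    have h := hX.integrable_inside_mul_step_sq (n := n) hr 0
    have h' := hX.integral_inside_mul_step_sq (r := r) (n := n) 0
    simp only [pow_zero, mul_one] at h h'
    have h1 := hX.integrable_stoppedWalk_sq (n := n) hr
    have h2 := (hX.integrable_inside_mul_step (n := n) hr 1).const_mul 2
    rw [integral_add ?_ h, integral_add h1 h2, integral_const_mul,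
      hX.integral_inside_mul_step, h', ih, hX.integral_stepCount_succ]
    · ring
    · exact h1.add h2

lemma integral_tailSum (hX : IsStandardSteps P X ν) :
    Integrable (tailSum X r c n) P ∧ ∫ ω, tailSum X r c n ω ∂P =
      (∫ x, tailSq c x ∂ν) * ∫ ω, stepCount X r n ω ∂P := by
  have hi : ∀ k ∈ Finset.range n, Integrable (fun ω => inside X r k ω * tailSq c (X k ω)) P :=
    fun k _ => hX.integrable_past_mul measurable_past_inside hX.integrable_inside
      (measurable_tailSq c) hX.integrable_tailSq
  refine ⟨integrable_finsetSum _ hi, ?_⟩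
  unfold tailSum stepCount
  rw [integral_finsetSum _ hi, integral_finsetSum _ fun k _ => hX.integrable_inside,
    Finset.mul_sum]
  refine Finset.sum_congr rfl fun k _ => ?_
  rw [hX.integral_past_mul measurable_past_inside (measurable_tailSq c), mul_comm]

/-- The weights of the steps made are `1, 2, …, T`, with sum `T (T + 1) / 2`; each is known before
its step is drawn. -/
lemma integral_weightedTailSum (hX : IsStandardSteps P X ν) :
    Integrable (weightedTailSum X r c n) P ∧ 2 * ∫ ω, weightedTailSum X r c n ω ∂P =
      (∫ x, tailSq c x ∂ν) *
        (∫ ω, stepCount X r n ω ^ 2 ∂P + ∫ ω, stepCount X r n ω ∂P) := by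
  have hg : ∀ k, Integrable (fun ω => inside X r k ω * (stepCount X r k ω + 1)) P := fun k => by
    refine ((hX.integrable_inside_stepCount (n := k) (r := r)).add
      (hX.integrable_inside (n := k) (r := r))).congr
      (ae_of_all _ fun ω => ?_)
    simp only [Pi.add_apply]; ring
  have hm : ∀ k, Measurable[past X k] (fun ω => inside X r k ω * (stepCount X r k ω + 1)) :=
    fun k => measurable_past_inside.mul (measurable_past_stepCount.add_const 1)
  have hi : ∀ k, Integrable
      (fun ω => (inside X r k ω * (stepCount X r k ω + 1)) * tailSq c (X k ω)) P :=
    fun k => hX.integrable_past_mul (hm k) (hg k) (measurable_tailSq c) hX.integrable_tailSq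
  have hint : ∀ n, Integrable (weightedTailSum X r c n) P :=
    fun n => integrable_finsetSum _ fun k _ => hi k
  refine ⟨hint n, ?_⟩
  induction n with
  | zero => simp [weightedTailSum, stepCount]
  | succ n ih =>
    have hs : ∀ ω, weightedTailSum X r c (n + 1) ω = weightedTailSum X r c n ω +
        (inside X r n ω * (stepCount X r n ω + 1)) * tailSq c (X n ω) := fun ω => by
      simp [weightedTailSum, Finset.sum_range_succ]
    have hk : ∫ ω, inside X r n ω * (stepCount X r n ω + 1) ∂P =
        ∫ ω, stepCount X r n ω * inside X r n ω ∂P + ∫ ω, inside X r n ω ∂P := by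
      rw [← integral_add hX.integrable_inside_stepCount hX.integrable_inside]
      exact integral_congr_ae (ae_of_all _ fun ω => by ring)
    simp_rw [hs]
    rw [integral_add (hint n) (hi n), mul_add, ih,
      hX.integral_past_mul (hm n) (measurable_tailSq c), hk, hX.integral_stepCount_sq_succ,
      hX.integral_stepCount_succ]
    ring

lemma integral_stepCount_mul_stoppedWalk_sq_succ (hX : IsStandardSteps P X ν) (hr : 0 ≤ r) :
    ∫ ω, stepCount X r (n + 1) ω * stoppedWalk X r (n + 1) ω ^ 2 ∂P =
      ∫ ω, stepCount X r n ω * stoppedWalk X r n ω ^ 2 ∂P +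
      ∫ ω, inside X r n ω * stoppedWalk X r n ω ^ 2 ∂P +
      ∫ ω, stepCount X r n ω * inside X r n ω ∂P + ∫ ω, inside X r n ω ∂P := by
  set T := stepCount X r n
  set I := inside X r n
  set Y := stoppedWalk X r n
  have h : ∀ ω, stepCount X r (n + 1) ω * stoppedWalk X r (n + 1) ω ^ 2 =
      T ω * Y ω ^ 2 + I ω * Y ω ^ 2 + 2 * ((T ω + 1) * (I ω * Y ω ^ 1) * X n ω) +
        ((T ω + 1) * I ω) * X n ω ^ 2 := fun ω => by
    rw [stepCount_succ, stoppedWalk_succ_sq]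
    linear_combination (2 * Y ω * X n ω + X n ω ^ 2) *
      inside_mul_self (X := X) (r := r) (n := n) (ω := ω)
  have mT : Measurable[past X n] (fun ω => T ω + 1) := measurable_past_stepCount.add_const 1
  have mIY : Measurable[past X n] (fun ω => I ω * Y ω ^ 1) :=
    measurable_past_inside.mul (measurable_past_stoppedWalk.pow_const 1)
  have i1 : Integrable (fun ω => (T ω + 1) * (I ω * Y ω ^ 1)) P := by
    refine ((hX.integrable_stepCount_mul (n := n) (r := r)
      (hX.integrable_inside_mul_pow (n := n) hr 1)).add
      (hX.integrable_inside_mul_pow (n := n) hr 1)).congr (ae_of_all _ fun ω => ?_)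
    simp only [Pi.add_apply, T, I, Y]; ring
  have i2 : Integrable (fun ω => (T ω + 1) * I ω) P := by
    refine ((hX.integrable_inside_stepCount (n := n) (r := r)).add
      (hX.integrable_inside (n := n) (r := r))).congr
      (ae_of_all _ fun ω => ?_)
    simp only [Pi.add_apply, T, I]; ring
  have j1 : Integrable (fun ω => T ω * Y ω ^ 2) P :=
    hX.integrable_stepCount_mul (hX.integrable_stoppedWalk_sq hr)
  have j2 : Integrable (fun ω => I ω * Y ω ^ 2) P := hX.integrable_inside_mul_pow hr 2
  have j3 : Integrable (fun ω => 2 * ((T ω + 1) * (I ω * Y ω ^ 1) * X n ω)) P :=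
    (hX.integrable_past_mul (φ := fun x => x) (mT.mul mIY) i1 measurable_id
      hX.integrable_id).const_mul 2
  have j4 : Integrable (fun ω => ((T ω + 1) * I ω) * X n ω ^ 2) P :=
    hX.integrable_past_mul (φ := fun x => x ^ 2) (mT.mul measurable_past_inside) i2 (by fun_prop)
      hX.integrable_sq
  have e3 : ∫ ω, (T ω + 1) * (I ω * Y ω ^ 1) * X n ω ∂P = 0 := by
    rw [hX.integral_past_mul (g := fun ω => (T ω + 1) * (I ω * Y ω ^ 1))
      (φ := fun x => x) (mT.mul mIY) measurable_id, hX.mean, mul_zero]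
  have e4 : ∫ ω, ((T ω + 1) * I ω) * X n ω ^ 2 ∂P =
      ∫ ω, T ω * I ω ∂P + ∫ ω, I ω ∂P := by
    rw [hX.integral_past_mul (g := fun ω => (T ω + 1) * I ω) (φ := fun x => x ^ 2)
      (mT.mul measurable_past_inside)
      (by fun_prop), hX.second, mul_one,
      ← integral_add hX.integrable_inside_stepCount hX.integrable_inside]
    exact integral_congr_ae (ae_of_all _ fun ω => by simp only [T, I]; ring)
  simp_rw [h]
  rw [integral_add ?_ j4, integral_add ?_ j3, integral_add j1 j2,
    integral_const_mul, e3, e4]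
  · ring
  · exact j1.add j2
  · exact (j1.add j2).add j3

lemma integrable_cappedQuartic (hX : IsStandardSteps P X ν) :
    Integrable (fun ω => cappedQuartic r (stoppedWalk X r n ω)) P :=
  hX.integrable_of_bound ((measurable_cappedQuartic r).comp hX.measurable_stoppedWalk) _ fun ω => by
    rw [abs_of_nonneg (cappedQuartic_nonneg _ _)]; exact cappedQuartic_le _ _

/-- In the Taylor expansion the term linear in the step has mean zero, and the quadratic one has
factor `E X² = 1`. The remainder is multiplied by `inside`, since a frozen walk contributes nothing.
-/
lemma abs_integral_cappedQuartic_succ_sub_le (hX : IsStandardSteps P X ν) (hr : 0 < r)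
    (hκ : 0 < κ) (hκ1 : κ ≤ 1) :
    |∫ ω, cappedQuartic r (stoppedWalk X r (n + 1) ω) ∂P -
      ∫ ω, cappedQuartic r (stoppedWalk X r n ω) ∂P -
      6 * ∫ ω, inside X r n ω * stoppedWalk X r n ω ^ 2 ∂P| ≤
    (5 * κ * r ^ 2 + 27 / κ ^ 2 * r ^ 2 * ∫ x, tailSq (κ * r) x ∂ν) *
      ∫ ω, inside X r n ω ∂P := by
  set I := inside X r n
  set Y := stoppedWalk X r n
  set q : Ω → ℝ := fun ω => cappedQuartic r (stoppedWalk X r (n + 1) ω)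
  set p : Ω → ℝ := fun ω => cappedQuartic r (Y ω)
  have hq : Integrable q P := hX.integrable_cappedQuartic
  have hp : Integrable p P := hX.integrable_cappedQuartic
  have j3 : Integrable (fun ω => 4 * (I ω * Y ω ^ 3 * X n ω)) P :=
    (hX.integrable_inside_mul_step hr.le 3).const_mul 4
  have j2 : Integrable (fun ω => 6 * (I ω * Y ω ^ 2 * X n ω ^ 2)) P :=
    (hX.integrable_inside_mul_step_sq hr.le 2).const_mul 6
  have hint : ∫ ω, (q ω - p ω - 4 * (I ω * Y ω ^ 3 * X n ω) -
      6 * (I ω * Y ω ^ 2 * X n ω ^ 2)) ∂P =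
      ∫ ω, q ω ∂P - ∫ ω, p ω ∂P - 6 * ∫ ω, I ω * Y ω ^ 2 ∂P := by
    rw [integral_sub ?_ j2, integral_sub ?_ j3, integral_sub hq hp,
      integral_const_mul, integral_const_mul, hX.integral_inside_mul_step,
      hX.integral_inside_mul_step_sq]
    · ring
    · exact hq.sub hp
    · exact (hq.sub hp).sub j3
  set φ : ℝ → ℝ := fun x => 5 * κ * r ^ 2 * x ^ 2 + 27 / κ ^ 2 * r ^ 2 * tailSq (κ * r) x
  have hφi : Integrable φ ν :=
    (hX.integrable_sq.const_mul _).add (hX.integrable_tailSq.const_mul _)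
  have hφm : Measurable φ := by
    have := measurable_tailSq (κ * r)
    fun_prop
  have hφ : ∫ x, φ x ∂ν = 5 * κ * r ^ 2 + 27 / κ ^ 2 * r ^ 2 * ∫ x, tailSq (κ * r) x ∂ν := by
    rw [integral_add (hX.integrable_sq.const_mul _) (hX.integrable_tailSq.const_mul _),
      integral_const_mul, integral_const_mul, hX.second, mul_one]
  rw [← hint, ← hφ, mul_comm, ← hX.integral_past_mul measurable_past_inside hφm]
  refine abs_integral_le_integral_abs.trans (integral_mono_of_nonneg
    (ae_of_all _ fun _ => abs_nonneg _)
    (hX.integrable_past_mul measurable_past_inside hX.integrable_inside hφm hφi)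
    (ae_of_all _ fun ω => ?_))
  simp only [q, p, stoppedWalk_succ, I, Y]
  rcases inside_cases (X := X) (r := r) (n := n) (ω := ω) with ⟨h1, h2⟩ | ⟨h1, h2⟩
  · rw [h1, cappedQuartic_eq (h2.trans (by linarith))]
    simpa [φ, mul_assoc] using abs_cappedQuartic_taylor_le (x := X n ω) hr hκ hκ1 h2
  · rw [h1]; simp

/-- Approximate optional stopping for the space-time polynomial `x ^ 4 - 6 t x ^ 2 + 3 t ^ 2`. -/
lemma abs_integral_spaceTime_le (hX : IsStandardSteps P X ν) (hr : 0 < r)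
    (hκ : 0 < κ) (hκ1 : κ ≤ 1) :
    |∫ ω, cappedQuartic r (stoppedWalk X r n ω) ∂P -
      6 * ∫ ω, stepCount X r n ω * stoppedWalk X r n ω ^ 2 ∂P +
      3 * ∫ ω, stepCount X r n ω ^ 2 ∂P + 3 * ∫ ω, stepCount X r n ω ∂P| ≤
    (5 * κ * r ^ 2 + 27 / κ ^ 2 * r ^ 2 * ∫ x, tailSq (κ * r) x ∂ν) *
      ∫ ω, stepCount X r n ω ∂P := by
  induction n with
  | zero =>
    have : cappedQuartic r 0 = 0 := by
      simpa using cappedQuartic_eq (r := r) (x := 0) (by simp; linarith)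
    simp [stoppedWalk, stepCount, this]
  | succ n ih =>
    have h := hX.abs_integral_cappedQuartic_succ_sub_le (n := n) hr hκ hκ1
    rw [hX.integral_stepCount_mul_stoppedWalk_sq_succ hr.le, hX.integral_stepCount_sq_succ,
      hX.integral_stepCount_succ]
    refine le_trans (le_of_eq ?_) (((abs_add_le _ _).trans (add_le_add ih h)).trans_eq
      (mul_add _ _ _).symm)
    -- With `I` for `inside`, the time terms change by `-6 (I Y² + T I + I) + 3 (2 T I + I) + 3 I =
    -- -6 I Y²`, which is the compensator in `h`. The correction `3 T` accounts for discrete time.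
    congr 1; ring

end IsStandardSteps

end Expectations

/-! ### Quantitative moment bounds and the limit of large time. -/

section Bounds

variable {Ω : Type*} [mΩ : MeasurableSpace Ω] {P : Measure Ω} [IsProbabilityMeasure P]
  {X : ℕ → Ω → ℝ} {ν : Measure ℝ} {r c κ : ℝ} {n : ℕ}

namespace IsStandardSteps

lemma integrable_overshoot_sq (hX : IsStandardSteps P X ν) (hr : 0 ≤ r) :
    Integrable (fun ω => overshoot X r n ω ^ 2) P := by
  refine ((integrable_const (0 ^ 2 : ℝ)).add
    (hX.integral_tailSum (c := 0) (r := r) (n := n)).1).mono'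
    (hX.measurable_overshoot.pow_const 2).aestronglyMeasurable (ae_of_all _ fun ω => ?_)
  rw [Real.norm_of_nonneg (by positivity)]
  exact overshoot_sq_le hr

lemma integral_overshoot_sq_le (hX : IsStandardSteps P X ν) (hr : 0 ≤ r) :
    ∫ ω, overshoot X r n ω ^ 2 ∂P ≤
      c ^ 2 + (∫ x, tailSq c x ∂ν) * ∫ ω, stepCount X r n ω ∂P := by
  obtain ⟨h1, h2⟩ := hX.integral_tailSum (c := c) (r := r) (n := n)
  calc ∫ ω, overshoot X r n ω ^ 2 ∂P ≤ ∫ ω, (c ^ 2 + tailSum X r c n ω) ∂P :=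
        integral_mono (hX.integrable_overshoot_sq hr) ((integrable_const _).add h1)
          fun ω => overshoot_sq_le hr
    _ = _ := by rw [integral_add (integrable_const _) h1, h2]; simp

lemma integral_stepCount_mul_overshoot_sq_le (hX : IsStandardSteps P X ν) (hr : 0 ≤ r) :
    ∫ ω, stepCount X r n ω * overshoot X r n ω ^ 2 ∂P ≤
      c ^ 2 * ∫ ω, stepCount X r n ω ∂P + (∫ x, tailSq c x ∂ν) *
        (∫ ω, stepCount X r n ω ^ 2 ∂P + ∫ ω, stepCount X r n ω ∂P) / 2 := by
  obtain ⟨h1, h2⟩ := hX.integral_weightedTailSum (c := c) (r := r) (n := n)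
  have h3 := (hX.integrable_stepCount (r := r) (n := n)).const_mul (c ^ 2)
  calc ∫ ω, stepCount X r n ω * overshoot X r n ω ^ 2 ∂P
      ≤ ∫ ω, (c ^ 2 * stepCount X r n ω + weightedTailSum X r c n ω) ∂P :=
        integral_mono (hX.integrable_stepCount_mul (hX.integrable_overshoot_sq hr)) (h3.add h1)
          fun ω => stepCount_mul_overshoot_sq_le
    _ = _ := by rw [integral_add h3 h1, integral_const_mul, ← h2]; ring

omit [IsProbabilityMeasure P] in
lemma integral_stepCount_nonneg : 0 ≤ ∫ ω, stepCount X r n ω ∂P :=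
  integral_nonneg fun _ => stepCount_nonneg

lemma integral_stepCount_le (hX : IsStandardSteps P X ν) (hr : 0 ≤ r) (hκ : 0 < κ) :
    ∫ ω, stepCount X r n ω ∂P ≤ (1 + κ) * r ^ 2 + (1 + 1 / κ) *
      (c ^ 2 + (∫ x, tailSq c x ∂ν) * ∫ ω, stepCount X r n ω ∂P) := by
  have h1 := (hX.integrable_overshoot_sq (n := n) hr).const_mul (1 + 1 / κ)
  calc ∫ ω, stepCount X r n ω ∂P = ∫ ω, stoppedWalk X r n ω ^ 2 ∂P :=
        (hX.integral_stoppedWalk_sq hr).symm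
    _ ≤ ∫ ω, ((1 + κ) * r ^ 2 + (1 + 1 / κ) * overshoot X r n ω ^ 2) ∂P :=
        integral_mono (hX.integrable_stoppedWalk_sq hr) ((integrable_const _).add h1)
          fun ω => sq_stoppedWalk_le hκ
    _ = (1 + κ) * r ^ 2 + (1 + 1 / κ) * ∫ ω, overshoot X r n ω ^ 2 ∂P := by
        rw [integral_add (integrable_const _) h1,
          integral_const_mul (μ := P) (_ : ℝ) fun ω => overshoot X r n ω ^ 2]
        simp
    _ ≤ _ := by
        have := hX.integral_overshoot_sq_le (c := c) (n := n) hr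
        gcongr

lemma le_integral_stepCount (hX : IsStandardSteps P X ν) (hr : 0 ≤ r) :
    r ^ 2 - r ^ 2 * ∫ ω, inside X r n ω ∂P ≤ ∫ ω, stepCount X r n ω ∂P := by
  have h1 := (hX.integrable_inside (r := r) (n := n)).const_mul (r ^ 2)
  calc r ^ 2 - r ^ 2 * ∫ ω, inside X r n ω ∂P = ∫ ω, (r ^ 2 - r ^ 2 * inside X r n ω) ∂P := by
        rw [integral_sub (integrable_const _) h1, integral_const_mul]; simp
    _ ≤ ∫ ω, stoppedWalk X r n ω ^ 2 ∂P :=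
        integral_mono ((integrable_const _).sub h1) (hX.integrable_stoppedWalk_sq hr)
          fun ω => le_sq_stoppedWalk hr
    _ = _ := hX.integral_stoppedWalk_sq hr

lemma integral_stepCount_mul_sq_le (hX : IsStandardSteps P X ν) (hr : 0 ≤ r) (hκ : 0 < κ) :
    ∫ ω, stepCount X r n ω * stoppedWalk X r n ω ^ 2 ∂P ≤
      (1 + κ) * r ^ 2 * ∫ ω, stepCount X r n ω ∂P + (1 + 1 / κ) *
      (c ^ 2 * ∫ ω, stepCount X r n ω ∂P + (∫ x, tailSq c x ∂ν) *
        (∫ ω, stepCount X r n ω ^ 2 ∂P + ∫ ω, stepCount X r n ω ∂P) / 2) := by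
  have h1 := (hX.integrable_stepCount_mul (r := r) (n := n)
    (hX.integrable_overshoot_sq (n := n) hr)).const_mul (1 + 1 / κ)
  have h2 := (hX.integrable_stepCount (r := r) (n := n)).const_mul ((1 + κ) * r ^ 2)
  calc ∫ ω, stepCount X r n ω * stoppedWalk X r n ω ^ 2 ∂P
      ≤ ∫ ω, ((1 + κ) * r ^ 2 * stepCount X r n ω +
          (1 + 1 / κ) * (stepCount X r n ω * overshoot X r n ω ^ 2)) ∂P := by
        refine integral_mono (hX.integrable_stepCount_mul (hX.integrable_stoppedWalk_sq hr))
          (h2.add h1) fun ω => ?_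
        have := mul_le_mul_of_nonneg_left (sq_stoppedWalk_le (X := X) (r := r) (n := n) (ω := ω) hκ)
          (stepCount_nonneg (X := X) (r := r) (n := n) (ω := ω))
        refine this.trans_eq ?_
        ring
    _ = (1 + κ) * r ^ 2 * ∫ ω, stepCount X r n ω ∂P +
          (1 + 1 / κ) * ∫ ω, stepCount X r n ω * overshoot X r n ω ^ 2 ∂P := by
        rw [integral_add h2 h1, integral_const_mul, integral_const_mul]
    _ ≤ _ := by
        have := hX.integral_stepCount_mul_overshoot_sq_le (c := c) (n := n) hr
        gcongr

lemma le_integral_stepCount_mul_sq (hX : IsStandardSteps P X ν) (hr : 0 ≤ r) :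
    r ^ 2 * ∫ ω, stepCount X r n ω ∂P - r ^ 2 * ∫ ω, stepCount X r n ω * inside X r n ω ∂P ≤
      ∫ ω, stepCount X r n ω * stoppedWalk X r n ω ^ 2 ∂P := by
  have h1 := (hX.integrable_inside_stepCount (r := r) (n := n)).const_mul (r ^ 2)
  have h2 := (hX.integrable_stepCount (r := r) (n := n)).const_mul (r ^ 2)
  rw [← integral_const_mul, ← integral_const_mul, ← integral_sub h2 h1]
  refine integral_mono (h2.sub h1)
    (hX.integrable_stepCount_mul (hX.integrable_stoppedWalk_sq hr)) fun ω => ?_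
  have := mul_le_mul_of_nonneg_left (le_sq_stoppedWalk (X := X) (r := r) (n := n) (ω := ω) hr)
    (stepCount_nonneg (X := X) (r := r) (n := n) (ω := ω))
  refine le_trans (le_of_eq ?_) this
  ring

lemma le_integral_cappedQuartic (hX : IsStandardSteps P X ν) (hr : 0 ≤ r) :
    r ^ 4 - r ^ 4 * ∫ ω, inside X r n ω ∂P ≤
      ∫ ω, cappedQuartic r (stoppedWalk X r n ω) ∂P := by
  have h1 := (hX.integrable_inside (r := r) (n := n)).const_mul (r ^ 4)
  calc r ^ 4 - r ^ 4 * ∫ ω, inside X r n ω ∂P = ∫ ω, (r ^ 4 - r ^ 4 * inside X r n ω) ∂P := by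
        rw [integral_sub (integrable_const _) h1, integral_const_mul]; simp
    _ ≤ _ := integral_mono ((integrable_const _).sub h1) hX.integrable_cappedQuartic
          fun ω => le_cappedQuartic_stoppedWalk hr

lemma integral_cappedQuartic_le (hX : IsStandardSteps P X ν) (hr : 0 ≤ r) (hκ : 0 < κ) :
    ∫ ω, cappedQuartic r (stoppedWalk X r n ω) ∂P ≤ r ^ 4 + 15 * κ * r ^ 4 / 2 +
      15 * r ^ 2 / (2 * κ) * (c ^ 2 + (∫ x, tailSq c x ∂ν) * ∫ ω, stepCount X r n ω ∂P) := by
  have h1 := (hX.integrable_overshoot_sq (n := n) hr).const_mul (15 * r ^ 2 / (2 * κ))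
  calc ∫ ω, cappedQuartic r (stoppedWalk X r n ω) ∂P
      ≤ ∫ ω, (r ^ 4 + 15 * κ * r ^ 4 / 2 + 15 * r ^ 2 / (2 * κ) * overshoot X r n ω ^ 2) ∂P := by
        refine integral_mono hX.integrable_cappedQuartic ((integrable_const _).add h1) fun ω => ?_
        refine (cappedQuartic_stoppedWalk_le hr).trans ?_
        have e : r ^ 4 + 15 * κ * r ^ 4 / 2 + 15 * r ^ 2 / (2 * κ) * overshoot X r n ω ^ 2 -
            (r ^ 4 + 15 * r ^ 3 * overshoot X r n ω) =
            15 * r ^ 2 / (2 * κ) * (κ * r - overshoot X r n ω) ^ 2 := by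
          field_simp; ring
        have : 0 ≤ 15 * r ^ 2 / (2 * κ) * (κ * r - overshoot X r n ω) ^ 2 := by positivity
        linarith
    _ = r ^ 4 + 15 * κ * r ^ 4 / 2 + 15 * r ^ 2 / (2 * κ) * ∫ ω, overshoot X r n ω ^ 2 ∂P := by
        rw [integral_add (integrable_const _) h1,
          integral_const_mul (μ := P) (_ : ℝ) fun ω => overshoot X r n ω ^ 2]
        simp
    _ ≤ _ := by
        have := hX.integral_overshoot_sq_le (c := c) (n := n) hr
        gcongr

/-- At `c = κ r` the unknown `M` reappears on the right with coefficient `(1 + 1/κ) κ³ ≤ κ`. Being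
finite, it can be absorbed on the left. -/
lemma integral_stepCount_le_of_tail_le (hX : IsStandardSteps P X ν) (hr : 0 ≤ r) (hκ : 0 < κ)
    (hκ1 : κ ≤ 1 / 100) (hψ : ∫ x, tailSq (κ * r) x ∂ν ≤ κ ^ 3) :
    ∫ ω, stepCount X r n ω ∂P ≤ (1 + 10 * κ) * r ^ 2 := by
  have h := hX.integral_stepCount_le (c := κ * r) (n := n) hr hκ
  have hM : 0 ≤ ∫ ω, stepCount X r n ω ∂P := integral_stepCount_nonneg
  set M := ∫ ω, stepCount X r n ω ∂P
  have h2 : (1 + 1 / κ) * ((κ * r) ^ 2 + (∫ x, tailSq (κ * r) x ∂ν) * M) ≤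
      (1 + 1 / κ) * ((κ * r) ^ 2 + κ ^ 3 * M) := by gcongr
  have h3 : (1 + 1 / κ) * ((κ * r) ^ 2 + κ ^ 3 * M) =
      (κ ^ 2 + κ) * r ^ 2 + (κ ^ 3 + κ ^ 2) * M := by field_simp
  have hk2 : κ ^ 2 ≤ κ / 100 := by nlinarith
  have hk3 : κ ^ 3 ≤ κ / 100 := by nlinarith
  have hR : 0 ≤ r ^ 2 := by positivity
  have h4 : M ≤ (1 + 3 * κ) * r ^ 2 + κ * M := by nlinarith
  have h5 : (1 + 3 * κ) * r ^ 2 ≤ (1 - κ) * ((1 + 10 * κ) * r ^ 2) := by nlinarith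
  have : (1 - κ) * M ≤ (1 - κ) * ((1 + 10 * κ) * r ^ 2) := by linarith
  exact le_of_mul_le_mul_left this (by linarith)

/-- The rate per step is at most `(5 + 27) κ r²`, and `32 (1 + 10 κ) ≤ 36`. -/
lemma abs_spaceTime_le_of_tail_le (hX : IsStandardSteps P X ν) (hr : 0 < r) (hκ : 0 < κ)
    (hκ1 : κ ≤ 1 / 100) (hψ : ∫ x, tailSq (κ * r) x ∂ν ≤ κ ^ 3) :
    |∫ ω, cappedQuartic r (stoppedWalk X r n ω) ∂P -
      6 * ∫ ω, stepCount X r n ω * stoppedWalk X r n ω ^ 2 ∂P +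
      3 * ∫ ω, stepCount X r n ω ^ 2 ∂P + 3 * ∫ ω, stepCount X r n ω ∂P| ≤ 36 * κ * r ^ 4 := by
  refine (hX.abs_integral_spaceTime_le hr hκ (by linarith)).trans ?_
  have hM := hX.integral_stepCount_le_of_tail_le (n := n) hr.le hκ hκ1 hψ
  have h1 : 27 / κ ^ 2 * r ^ 2 * ∫ x, tailSq (κ * r) x ∂ν ≤ 27 / κ ^ 2 * r ^ 2 * κ ^ 3 := by
    gcongr
  have h2 : 27 / κ ^ 2 * r ^ 2 * κ ^ 3 = 27 * κ * r ^ 2 := by field_simp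
  calc _ ≤ (5 * κ * r ^ 2 + 27 * κ * r ^ 2) * ((1 + 10 * κ) * r ^ 2) := by
        refine mul_le_mul (by linarith) hM integral_stepCount_nonneg (by positivity)
    _ = (32 * κ) * (1 + 10 * κ) * r ^ 4 := by ring
    _ ≤ 36 * κ * r ^ 4 := by
        have : (32 * κ) * (1 + 10 * κ) ≤ 36 * κ := by nlinarith
        gcongr

/-- Upper bound for the second moment of the number of steps, up to the survival probability. -/
lemma integral_stepCount_sq_le (hX : IsStandardSteps P X ν) (hr : 0 < r) (hκ : 0 < κ)
    (hκ1 : κ ≤ 1 / 100) (hψ : ∫ x, tailSq (κ * r) x ∂ν ≤ κ ^ 3) :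
    (3 - 6 * κ) * ∫ ω, stepCount X r n ω ^ 2 ∂P ≤
      (5 + 150 * κ) * r ^ 4 + r ^ 4 * ∫ ω, inside X r n ω ∂P := by
  have h1 := (abs_le.1 (hX.abs_spaceTime_le_of_tail_le (n := n) hr hκ hκ1 hψ)).2
  have h2 := hX.le_integral_cappedQuartic (n := n) hr.le
  have h3 := hX.integral_stepCount_mul_sq_le (c := κ * r) (n := n) hr.le hκ
  have hM := hX.integral_stepCount_le_of_tail_le (n := n) hr.le hκ hκ1 hψ
  have hM0 : 0 ≤ ∫ ω, stepCount X r n ω ∂P := integral_stepCount_nonneg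
  have hS0 : 0 ≤ ∫ ω, stepCount X r n ω ^ 2 ∂P := integral_nonneg fun _ => sq_nonneg _
  set M := ∫ ω, stepCount X r n ω ∂P
  set S := ∫ ω, stepCount X r n ω ^ 2 ∂P
  have h4 : (1 + 1 / κ) * ((κ * r) ^ 2 * M + (∫ x, tailSq (κ * r) x ∂ν) * (S + M) / 2) ≤
      (1 + 1 / κ) * ((κ * r) ^ 2 * M + κ ^ 3 * (S + M) / 2) := by gcongr
  have h5 : (1 + 1 / κ) * ((κ * r) ^ 2 * M + κ ^ 3 * (S + M) / 2) =
      (κ ^ 2 + κ) * (r ^ 2 * M) + (κ ^ 3 + κ ^ 2) / 2 * (S + M) := by field_simp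
  have hk2 : κ ^ 2 ≤ κ / 100 := by nlinarith
  have hk3 : κ ^ 3 ≤ κ / 100 := by nlinarith
  have hrM : 0 ≤ r ^ 2 * M := by positivity
  have h6 : (κ ^ 2 + κ) * (r ^ 2 * M) ≤ 2 * κ * (r ^ 2 * M) := by
    gcongr; linarith
  have h7 : (κ ^ 3 + κ ^ 2) / 2 * (S + M) ≤ κ * (S + M) := by
    gcongr; linarith
  have h8 : r ^ 2 * M ≤ (1 + 10 * κ) * r ^ 4 := by
    have := mul_le_mul_of_nonneg_left hM (by positivity : 0 ≤ r ^ 2)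
    linarith
  have h9 : (1 + 3 * κ) * (r ^ 2 * M) ≤ (1 + 3 * κ) * ((1 + 10 * κ) * r ^ 4) := by gcongr
  have h10 : (1 + 3 * κ) * ((1 + 10 * κ) * r ^ 4) ≤ (1 + 14 * κ) * r ^ 4 := by
    have : (1 + 3 * κ) * (1 + 10 * κ) ≤ 1 + 14 * κ := by nlinarith
    have := mul_le_mul_of_nonneg_right this (by positivity : 0 ≤ r ^ 4)
    linarith
  -- The overshoot contributes `6 κ (S + M)`: the part in `S` moves to the left side, and the part
  -- in `M` is absorbed by the `3 M` of the space-time identity.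
  have h11 : κ * M ≤ M / 100 := by nlinarith
  have h12 : 0 ≤ κ * r ^ 4 := by positivity
  linarith

/-- Lower bound for the second moment of the number of steps, up to survival terms. -/
lemma le_integral_stepCount_sq (hX : IsStandardSteps P X ν) (hr : 0 < r) (hκ : 0 < κ)
    (hκ1 : κ ≤ 1 / 100) (hψ : ∫ x, tailSq (κ * r) x ∂ν ≤ κ ^ 3) (hκr : 1 ≤ κ * r ^ 2) :
    (5 - 70 * κ) * r ^ 4 - 6 * r ^ 4 * ∫ ω, inside X r n ω ∂P -
      6 * r ^ 2 * ∫ ω, stepCount X r n ω * inside X r n ω ∂P ≤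
      3 * ∫ ω, stepCount X r n ω ^ 2 ∂P := by
  have h1 := (abs_le.1 (hX.abs_spaceTime_le_of_tail_le (n := n) hr hκ hκ1 hψ)).1
  have h2 := hX.integral_cappedQuartic_le (c := κ * r) (n := n) hr.le hκ
  have h3 := hX.le_integral_stepCount_mul_sq (n := n) hr.le
  have hM := hX.integral_stepCount_le_of_tail_le (n := n) hr.le hκ hκ1 hψ
  have hM1 := hX.le_integral_stepCount (n := n) hr.le
  have hM0 : 0 ≤ ∫ ω, stepCount X r n ω ∂P := integral_stepCount_nonneg
  set M := ∫ ω, stepCount X r n ω ∂P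
  have h4 : 15 * r ^ 2 / (2 * κ) * ((κ * r) ^ 2 + (∫ x, tailSq (κ * r) x ∂ν) * M) ≤
      15 * r ^ 2 / (2 * κ) * ((κ * r) ^ 2 + κ ^ 3 * ((1 + 10 * κ) * r ^ 2)) := by gcongr
  have h5 : 15 * r ^ 2 / (2 * κ) * ((κ * r) ^ 2 + κ ^ 3 * ((1 + 10 * κ) * r ^ 2)) =
      15 / 2 * (κ + κ ^ 2 * (1 + 10 * κ)) * r ^ 4 := by field_simp
  have hk : 15 / 2 * (κ + κ ^ 2 * (1 + 10 * κ)) ≤ 8 * κ := by nlinarith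
  have h6 := mul_le_mul_of_nonneg_right hk (by positivity : 0 ≤ r ^ 4)
  -- The discrete-time correction is only of order `r²`; `hκr` makes it an error of order `κ r⁴`.
  have h7 : 3 * M ≤ 4 * κ * r ^ 4 := by
    have e1 : (1 + 10 * κ) * r ^ 2 ≤ (4 / 3) * r ^ 2 := by gcongr; linarith
    have e2 : r ^ 2 * 1 ≤ r ^ 2 * (κ * r ^ 2) := by gcongr
    have : r ^ 2 ≤ κ * r ^ 4 := by nlinarith
    linarith
  have h8 := mul_le_mul_of_nonneg_left hM1 (by positivity : 0 ≤ r ^ 2)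
  have h12 : 0 ≤ κ * r ^ 4 := by positivity
  nlinarith

/-- The first two moments of the number of steps before exit. -/
lemma exists_limit_moments (hX : IsStandardSteps P X ν) (hr : 0 < r) (hκ : 0 < κ)
    (hκ1 : κ ≤ 1 / 100) (hψ : ∫ x, tailSq (κ * r) x ∂ν ≤ κ ^ 3) (hκr : 1 ≤ κ * r ^ 2) :
    ∃ A B : ℝ, Tendsto (fun n => ∫ ω, stepCount X r n ω ∂P) atTop (𝓝 A) ∧
      Tendsto (fun n => ∫ ω, stepCount X r n ω ^ 2 ∂P) atTop (𝓝 B) ∧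
      r ^ 2 ≤ A ∧ A ≤ (1 + 10 * κ) * r ^ 2 ∧ |B - 5 / 3 * r ^ 4| ≤ 100 * κ * r ^ 4 := by
  have hr4 : 0 ≤ r ^ 4 := by positivity
  have mono1 : Monotone fun n => ∫ ω, stepCount X r n ω ∂P := fun a b h =>
    integral_mono hX.integrable_stepCount hX.integrable_stepCount fun ω => stepCount_mono h
  have mono2 : Monotone fun n => ∫ ω, stepCount X r n ω ^ 2 ∂P := fun a b h =>
    integral_mono hX.integrable_stepCount_sq hX.integrable_stepCount_sq fun ω =>
      pow_le_pow_left₀ stepCount_nonneg (stepCount_mono h) 2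
  have hp1 : ∀ n, ∫ ω, inside X r n ω ∂P ≤ 1 := fun n => by
    have := integral_mono (hX.integrable_inside (r := r) (n := n)) (integrable_const (1 : ℝ))
      fun ω => inside_le_one
    simpa using this
  have bdd1 : BddAbove (Set.range fun n => ∫ ω, stepCount X r n ω ∂P) :=
    ⟨_, by rintro _ ⟨n, rfl⟩; exact hX.integral_stepCount_le_of_tail_le hr.le hκ hκ1 hψ⟩
  have bdd2 : BddAbove (Set.range fun n => ∫ ω, stepCount X r n ω ^ 2 ∂P) := by
    refine ⟨(6 + 150 * κ) * r ^ 4, ?_⟩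
    rintro _ ⟨n, rfl⟩
    have h1 := hX.integral_stepCount_sq_le (n := n) hr hκ hκ1 hψ
    have h2 : 0 ≤ ∫ ω, stepCount X r n ω ^ 2 ∂P := integral_nonneg fun _ => sq_nonneg _
    have h3 := mul_le_mul_of_nonneg_left (hp1 n) hr4
    have h4 : 1 * ∫ ω, stepCount X r n ω ^ 2 ∂P ≤
        (3 - 6 * κ) * ∫ ω, stepCount X r n ω ^ 2 ∂P := by gcongr; linarith
    simp only
    linarith
  have t1 := tendsto_atTop_ciSup mono1 bdd1
  have t2 := tendsto_atTop_ciSup mono2 bdd2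
  set A := ⨆ n, ∫ ω, stepCount X r n ω ∂P
  set B := ⨆ n, ∫ ω, stepCount X r n ω ^ 2 ∂P
  -- Survival probabilities are the increments of the convergent sequence `E T`; likewise `tq` comes
  -- from the increments of `E T²`.
  have tp : Tendsto (fun n => ∫ ω, inside X r n ω ∂P) atTop (𝓝 0) := by
    have := (t1.comp (tendsto_add_atTop_nat 1)).sub t1
    rw [sub_self] at this
    refine this.congr fun n => ?_
    simp only [Function.comp_apply, hX.integral_stepCount_succ]; ring
  have tq : Tendsto (fun n => ∫ ω, stepCount X r n ω * inside X r n ω ∂P) atTop (𝓝 0) := by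
    have := (((t2.comp (tendsto_add_atTop_nat 1)).sub t2).sub tp).div_const 2
    rw [sub_self, sub_zero, zero_div] at this
    refine this.congr fun n => ?_
    simp only [Function.comp_apply, hX.integral_stepCount_sq_succ]; ring
  refine ⟨A, B, t1, t2, ?_, ?_, ?_⟩
  · have := (tp.const_mul (r ^ 2)).const_sub (r ^ 2)
    rw [mul_zero, sub_zero] at this
    exact le_of_tendsto_of_tendsto' this t1 fun n => hX.le_integral_stepCount hr.le
  · exact le_of_tendsto' t1 fun n => hX.integral_stepCount_le_of_tail_le hr.le hκ hκ1 hψ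
  · have up : (3 - 6 * κ) * B ≤ (5 + 150 * κ) * r ^ 4 := by
      have := (tp.const_mul (r ^ 4)).const_add ((5 + 150 * κ) * r ^ 4)
      rw [mul_zero, add_zero] at this
      exact le_of_tendsto_of_tendsto' (t2.const_mul _) this
        fun n => hX.integral_stepCount_sq_le hr hκ hκ1 hψ
    have lo : (5 - 70 * κ) * r ^ 4 ≤ 3 * B := by
      have := ((tp.const_mul (6 * r ^ 4)).const_sub ((5 - 70 * κ) * r ^ 4)).sub
        (tq.const_mul (6 * r ^ 2))
      rw [mul_zero, sub_zero, mul_zero, sub_zero] at this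
      exact le_of_tendsto_of_tendsto' this (t2.const_mul _)
        fun n => hX.le_integral_stepCount_sq hr hκ hκ1 hψ hκr
    have h12 : 0 ≤ κ * r ^ 4 := by positivity
    have up' : B ≤ (5 / 3 + 100 * κ) * r ^ 4 := by
      -- The product equals `5 + 290 κ - 600 κ²`, which leaves room for the constant `100`.
      have e : (5 + 150 * κ) * r ^ 4 ≤ (3 - 6 * κ) * ((5 / 3 + 100 * κ) * r ^ 4) := by
        have : 5 + 150 * κ ≤ (3 - 6 * κ) * (5 / 3 + 100 * κ) := by nlinarith
        have := mul_le_mul_of_nonneg_right this hr4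
        linarith
      exact le_of_mul_le_mul_left (up.trans e) (by linarith)
    rw [abs_le]
    constructor <;> linarith

end IsStandardSteps

end Bounds

/-! ### Identification of the step count with the truncated exit index. -/

section ExitIndex

variable {Ω : Type*} {X G : ℕ → Ω → ℝ} {y : ℕ → Ω → ℝ} {r a ε : ℝ} {n m : ℕ} {ω : Ω}

lemma stoppedWalk_eq_sum (h : ∀ i < n, |∑ k ∈ Finset.range i, X k ω| ≤ r) :
    stoppedWalk X r n ω = ∑ k ∈ Finset.range n, X k ω := by
  induction n with
  | zero => simp [stoppedWalk]
  | succ n ih =>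
    have h1 := ih fun i hi => h i (hi.trans n.lt_succ_self)
    rw [stoppedWalk_succ, h1, Finset.sum_range_succ, inside, h1, if_pos (h n n.lt_succ_self),
      one_mul]

lemma lt_abs_stoppedWalk (hm : r < |∑ k ∈ Finset.range m, X k ω|)
    (h : ∀ i < m, |∑ k ∈ Finset.range i, X k ω| ≤ r) (hmn : m ≤ n) :
    r < |stoppedWalk X r n ω| := by
  induction n, hmn using Nat.le_induction with
  | base => rwa [stoppedWalk_eq_sum h]
  | succ n _ ih => rwa [stoppedWalk_succ, inside, if_neg (not_le.2 ih), zero_mul, add_zero]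

lemma stepCount_eq_natCast (h : ∀ i, |∑ k ∈ Finset.range i, X k ω| ≤ r) :
    stepCount X r n ω = n := by
  have : ∀ k ∈ Finset.range n, inside X r k ω = 1 := fun k _ => by
    rw [inside, stoppedWalk_eq_sum fun i _ => h i, if_pos (h k)]
  rw [stepCount, Finset.sum_congr rfl this]; simp

lemma stepCount_eq_of_exit (hm : r < |∑ k ∈ Finset.range m, X k ω|)
    (h : ∀ i < m, |∑ k ∈ Finset.range i, X k ω| ≤ r) (hmn : m ≤ n) :
    stepCount X r n ω = m := by
  induction n, hmn using Nat.le_induction with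
  | base =>
    have : ∀ k ∈ Finset.range m, inside X r k ω = 1 := fun k hk => by
      have hk := Finset.mem_range.1 hk
      rw [inside, stoppedWalk_eq_sum fun i hi => h i (hi.trans hk), if_pos (h k hk)]
    rw [stepCount, Finset.sum_congr rfl this]; simp
  | succ n hn ih =>
    rw [stepCount_succ, ih, inside, if_neg (not_le.2 (lt_abs_stoppedWalk hm h hn)), add_zero]

lemma keysCovered_eq_top (h : ∀ i : ℕ, ¬(y i ω > a * i + ε ∨ y i ω < a * i - ε)) :
    keysCovered y a ε ω = ⊤ := by
  simp only [keysCovered, iInf_eq_top]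
  exact fun i hi => absurd hi (h i)

lemma keysCovered_le {i : ℕ} (h : y i ω > a * i + ε ∨ y i ω < a * i - ε) :
    keysCovered y a ε ω ≤ i := iInf₂_le i h

lemma keysCovered_eq_natCast (hm : y m ω > a * m + ε ∨ y m ω < a * m - ε)
    (h : ∀ i < m, ¬(y i ω > a * i + ε ∨ y i ω < a * i - ε)) :
    keysCovered y a ε ω = m := by
  refine le_antisymm (keysCovered_le hm) (le_iInf₂ fun i hi => ?_)
  by_contra hlt
  exact h i (by simpa using hlt) hi

lemma exit_of_keysCovered_ne_top (h : keysCovered y a ε ω ≠ ⊤) :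
    ∃ m : ℕ, keysCovered y a ε ω = m ∧ (y m ω > a * m + ε ∨ y m ω < a * m - ε) ∧
      ∀ i < m, ¬(y i ω > a * i + ε ∨ y i ω < a * i - ε) := by
  classical
  have hex : ∃ m : ℕ, y m ω > a * m + ε ∨ y m ω < a * m - ε := by
    by_contra hn
    exact h (keysCovered_eq_top (not_exists.1 hn))
  exact ⟨Nat.find hex, keysCovered_eq_natCast (Nat.find_spec hex) fun i hi => Nat.find_min hex hi,
    Nat.find_spec hex, fun i hi => Nat.find_min hex hi⟩

end ExitIndex

/-! ### Moments of the exit index and standardization of the gaps. -/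

section Discrete

variable {Ω : Type*} [mΩ : MeasurableSpace Ω] {P : Measure Ω} [IsProbabilityMeasure P]
  {X : ℕ → Ω → ℝ} {ν : Measure ℝ} {r κ : ℝ}

/-- First two moments of the exit index of a random walk with standard steps. -/
lemma IsStandardSteps.moments_keysCovered (hX : IsStandardSteps P X ν) (hr : 0 < r) (hκ : 0 < κ)
    (hκ1 : κ ≤ 1 / 100) (hψ : ∫ x, tailSq (κ * r) x ∂ν ≤ κ ^ 3) (hκr : 1 ≤ κ * r ^ 2)
    {y : ℕ → Ω → ℝ} {a ε : ℝ}
    (hy : ∀ᵐ ω ∂P, ∀ i : ℕ, (y i ω > a * i + ε ∨ y i ω < a * i - ε) ↔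
      r < |∑ k ∈ Finset.range i, X k ω|) :
    (∀ᵐ ω ∂P, keysCovered y a ε ω ≠ ⊤) ∧
    MemLp (fun ω => ((keysCovered y a ε ω).toNat : ℝ)) 2 P ∧
    r ^ 2 ≤ ∫ ω, ((keysCovered y a ε ω).toNat : ℝ) ∂P ∧
    ∫ ω, ((keysCovered y a ε ω).toNat : ℝ) ∂P ≤ (1 + 10 * κ) * r ^ 2 ∧
    |∫ ω, ((keysCovered y a ε ω).toNat : ℝ) ^ 2 ∂P - 5 / 3 * r ^ 4| ≤ 100 * κ * r ^ 4 := by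
  obtain ⟨A, B, tA, tB, hA1, hA2, hB⟩ := hX.exists_limit_moments hr hκ hκ1 hψ hκr
  set N := keysCovered y a ε
  have hfin : ∀ᵐ ω ∂P, N ω ≠ ⊤ →
      Tendsto (fun n => stepCount X r n ω) atTop (𝓝 ((N ω).toNat : ℝ)) := by
    filter_upwards [hy] with ω hω hN
    obtain ⟨m, h1, h2, h3⟩ := exit_of_keysCovered_ne_top hN
    simp only [N, h1, ENat.toNat_natCast]
    refine tendsto_const_nhds.congr' ?_
    filter_upwards [eventually_ge_atTop m] with n hn
    exact (stepCount_eq_of_exit ((hω m).1 h2) (fun i hi => not_lt.1 fun h => h3 i hi ((hω i).2 h))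
      hn).symm
  -- On a path that never exits, the step count is `n` and its square tends to `⊤`. Finiteness of
  -- the limiting integral thus forces almost sure exit, and measurability of the exit index is
  -- inherited from the step counts.
  have hlim : ∀ᵐ ω ∂P, Tendsto (fun n => ENNReal.ofReal (stepCount X r n ω ^ 2)) atTop
      (𝓝 (if N ω = ⊤ then ⊤ else ENNReal.ofReal (((N ω).toNat : ℝ) ^ 2))) := by
    filter_upwards [hy, hfin] with ω hω hf
    split_ifs with hN
    · have hle : ∀ i, |∑ k ∈ Finset.range i, X k ω| ≤ r := fun i => not_lt.1 fun h =>
        ENat.natCast_ne_top i (top_le_iff.1 (hN ▸ keysCovered_le ((hω i).2 h)))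
      simp_rw [stepCount_eq_natCast hle]
      exact ENNReal.tendsto_ofReal_nhds_top.2
        ((tendsto_pow_atTop two_ne_zero).comp tendsto_natCast_atTop_atTop)
    · exact ENNReal.tendsto_ofReal ((hf hN).pow 2)
  have hlint := lintegral_tendsto_of_tendsto_of_monotone
    (fun n => ((hX.measurable_stepCount (r := r) (n := n)).pow_const 2).ennreal_ofReal.aemeasurable)
    (ae_of_all P fun ω i j hij => ENNReal.ofReal_le_ofReal
      (pow_le_pow_left₀ stepCount_nonneg (stepCount_mono (X := X) (r := r) (ω := ω) hij) 2)) hlim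
  have hlint' : Tendsto (fun n => ∫⁻ ω, ENNReal.ofReal (stepCount X r n ω ^ 2) ∂P) atTop
      (𝓝 (ENNReal.ofReal B)) := by
    refine (ENNReal.tendsto_ofReal tB).congr fun n => ?_
    exact ofReal_integral_eq_lintegral_ofReal hX.integrable_stepCount_sq
      (ae_of_all _ fun _ => sq_nonneg _)
  have heq := tendsto_nhds_unique hlint hlint'
  have hmeas : AEMeasurable (fun ω => if N ω = ⊤ then ⊤ else
      ENNReal.ofReal (((N ω).toNat : ℝ) ^ 2)) P :=
    aemeasurable_of_tendsto_metrizable_ae atTop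
      (fun n => ((hX.measurable_stepCount (r := r) (n := n)).pow_const
        2).ennreal_ofReal.aemeasurable) hlim
  have hNtop : ∀ᵐ ω ∂P, N ω ≠ ⊤ := by
    filter_upwards [ae_lt_top' hmeas (heq ▸ ENNReal.ofReal_ne_top)] with ω hω hN
    simp [hN] at hω
  have hT : ∀ᵐ ω ∂P, Tendsto (fun n => stepCount X r n ω) atTop (𝓝 ((N ω).toNat : ℝ)) := by
    filter_upwards [hfin, hNtop] with ω h1 h2 using h1 h2
  have hm : AEMeasurable (fun ω => ((N ω).toNat : ℝ)) P :=
    aemeasurable_of_tendsto_metrizable_ae atTop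
      (fun n => (hX.measurable_stepCount (r := r) (n := n)).aemeasurable) hT
  have hlsq : ∫⁻ ω, ENNReal.ofReal (((N ω).toNat : ℝ) ^ 2) ∂P = ENNReal.ofReal B := by
    rw [← heq]
    refine lintegral_congr_ae ?_
    filter_upwards [hNtop] with ω hω
    rw [if_neg hω]
  have hisq : Integrable (fun ω => ((N ω).toNat : ℝ) ^ 2) P := by
    refine (lintegral_ofReal_ne_top_iff_integrable (hm.pow_const 2).aestronglyMeasurable
      (ae_of_all _ fun _ => sq_nonneg _)).1 ?_
    rw [hlsq]; exact ENNReal.ofReal_ne_top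
  have hL2 : MemLp (fun ω => ((N ω).toNat : ℝ)) 2 P :=
    (memLp_two_iff_integrable_sq hm.aestronglyMeasurable).2 hisq
  have hint : Integrable (fun ω => ((N ω).toNat : ℝ)) P := hL2.integrable (by norm_num)
  have hA : ∫ ω, ((N ω).toNat : ℝ) ∂P = A :=
    tendsto_nhds_unique (integral_tendsto_of_tendsto_of_monotone
      (fun n => hX.integrable_stepCount) hint (ae_of_all _ fun ω => stepCount_mono) hT) tA
  have hB' : ∫ ω, ((N ω).toNat : ℝ) ^ 2 ∂P = B :=
    tendsto_nhds_unique (integral_tendsto_of_tendsto_of_monotone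
      (fun n => hX.integrable_stepCount_sq) hisq
      (ae_of_all _ fun ω i j hij => pow_le_pow_left₀ stepCount_nonneg (stepCount_mono hij) 2)
      (by filter_upwards [hT] with ω hω using hω.pow 2)) tB
  rw [hA, hB']
  exact ⟨hNtop, hL2, hA1, hA2, hB⟩

lemma tendsto_integral_tailSq {ν : Measure ℝ} (h : Integrable (fun x : ℝ => x ^ 2) ν) :
    Tendsto (fun c => ∫ x, tailSq c x ∂ν) atTop (𝓝 0) := by
  have := tendsto_integral_filter_of_dominated_convergence (μ := ν) (l := atTop)
    (F := fun c : ℝ => tailSq c) (f := fun _ => (0 : ℝ)) (fun x => x ^ 2)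
    (Eventually.of_forall fun c => (measurable_tailSq c).aestronglyMeasurable)
    (Eventually.of_forall fun c => ae_of_all _ fun x => by
      rw [Real.norm_of_nonneg (tailSq_nonneg _ _)]; exact tailSq_le _ _) h
    (ae_of_all _ fun x => tendsto_const_nhds.congr' (by
      filter_upwards [eventually_ge_atTop |x|] with c hc
      rw [tailSq, if_neg (not_lt.2 hc)]))
  simpa using this

/-- The standardized gaps, up to modification on a null set, are standard steps. -/
lemma IsGapSequence.exists_isStandardSteps {G : ℕ → Ω → ℝ} {μ σ : ℝ}
    (hG : IsGapSequence P G μ σ) (hσ : 0 < σ) :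
    ∃ X : ℕ → Ω → ℝ, IsStandardSteps P X (P.map fun ω => (G 0 ω - μ) / σ) ∧
      ∀ᵐ ω ∂P, ∀ i, X i ω = (G i ω - μ) / σ := by
  have hm : ∀ i, AEMeasurable (G i) P := fun i => (hG.identDistrib i).aemeasurable_fst
  have hφ : Measurable fun x : ℝ => (x - μ) / σ := by fun_prop
  have hae : ∀ i, (fun ω => ((hm i).mk (G i) ω - μ) / σ) =ᵐ[P] fun ω => (G i ω - μ) / σ :=
    fun i => by
      filter_upwards [(hm i).ae_eq_mk] with ω hω
      rw [← hω]
  have hm0 : AEMeasurable (fun ω => (G 0 ω - μ) / σ) P := hφ.comp_aemeasurable (hm 0)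
  have hsq : Integrable (fun ω => (G 0 ω - μ) ^ 2) P :=
    (hG.memLp.sub (memLp_const μ)).integrable_sq
  have hint : Integrable (G 0) P := hG.memLp.integrable (by norm_num)
  -- The gaps are only almost everywhere measurable; measurable versions make `past` a genuine
  -- sub-sigma-algebra.
  refine ⟨fun i ω => ((hm i).mk (G i) ω - μ) / σ, ⟨?_, ?_, ?_, ?_, ?_, ?_⟩, ae_all_iff.2 hae⟩
  · exact fun i => hφ.comp (hm i).measurable_mk
  · exact (hG.indep.comp (fun _ x => (x - μ) / σ) fun _ => hφ).congr fun i => (hae i).symm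
  · intro i
    rw [Measure.map_congr (hae i)]
    exact ((hG.identDistrib i).comp hφ).map_eq
  · rw [integrable_map_measure (by fun_prop) hm0]
    refine (hsq.div_const (σ ^ 2)).congr (ae_of_all _ fun ω => ?_)
    simp [div_pow]
  · rw [integral_map hm0 (by fun_prop), integral_div, integral_sub hint (integrable_const _),
      hG.mean]
    simp
  · have hv := hG.variance
    rw [variance_eq_integral (hm 0), hG.mean] at hv
    rw [integral_map hm0 (by fun_prop)]
    simp_rw [div_pow]
    rw [integral_div, hv, div_self (by positivity)]

omit mΩ in
lemma exit_iff_lt_abs_sum {G X : ℕ → Ω → ℝ} {μ σ ε : ℝ} (hσ : 0 < σ) {ω : Ω}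
    (h : ∀ i, X i ω = (G i ω - μ) / σ) (i : ℕ) :
    (key G i ω > μ * i + ε ∨ key G i ω < μ * i - ε) ↔
      ε / σ < |∑ k ∈ Finset.range i, X k ω| := by
  have hs : ∑ k ∈ Finset.range i, X k ω = (key G i ω - μ * i) / σ := by
    simp_rw [h, ← Finset.sum_div, key]
    simp [mul_comm]
  rw [hs, abs_div, abs_of_pos hσ, div_lt_div_iff_of_pos_right hσ, lt_abs]
  constructor
  · rintro (h | h)
    · left; linarith
    · right; linarith
  · rintro (h | h)
    · left; linarith
    · right; linarith

end Discrete

/-- Asymptotics of the second moment and the variance of the number of covered keys. -/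
theorem keysCovered_second_moment_and_variance.{u} (ν : Measure ℝ) (δ : ℝ) (hδ : 0 < δ) :
    ∃ K : ℝ, 0 < K ∧
      ∀ (Ω : Type u) [MeasurableSpace Ω] (P : Measure Ω) [IsProbabilityMeasure P]
        (G : ℕ → Ω → ℝ) (μ σ ε : ℝ), 0 < σ → IsGapSequence P G μ σ →
        P.map (fun ω => (G 0 ω - μ) / σ) = ν → K * σ ≤ ε →
        (∀ᵐ ω ∂P, keysCovered (key G) μ ε ω ≠ ⊤) ∧
        MemLp (fun ω => ((keysCovered (key G) μ ε ω).toNat : ℝ)) 2 P ∧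
        |(∫ ω, ((keysCovered (key G) μ ε ω).toNat : ℝ) ^ 2 ∂P)
            - 5 * ε ^ 4 / (3 * σ ^ 4)| ≤ δ * (ε ^ 4 / σ ^ 4) ∧
        |Var[fun ω => ((keysCovered (key G) μ ε ω).toNat : ℝ); P]
            - 2 * ε ^ 4 / (3 * σ ^ 4)| ≤ δ * (ε ^ 4 / σ ^ 4) := by
  -- If `ν` has no second moment, no gap sequence has this standardized law, and any `K` works.
  by_cases hν : Integrable (fun x : ℝ => x ^ 2) ν
  swap
  · refine ⟨1, one_pos, fun Ω _ P _ G μ σ ε hσ hG hlaw _ => absurd ?_ hν⟩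
    obtain ⟨X, hX, -⟩ := hG.exists_isStandardSteps hσ
    rw [hlaw] at hX
    exact hX.integrable_sq
  -- The error is `100 κ` for the second moment and at most `121 κ` for the variance, the squared
  -- mean adding `21 κ`.
  set κ := min (1 / 100) (δ / 200)
  have hκ : 0 < κ := lt_min (by norm_num) (by positivity)
  have hκ1 : κ ≤ 1 / 100 := min_le_left _ _
  have hκδ : κ ≤ δ / 200 := min_le_right _ _
  obtain ⟨c, hc⟩ := eventually_atTop.1
    ((tendsto_integral_tailSq hν).eventually (ge_mem_nhds (by positivity : 0 < κ ^ 3)))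
  -- This `K` ensures `κ r ≥ c`, for the tail bound, and `κ r ≥ 1`, hence `κ r² ≥ 1`.
  refine ⟨max c 1 / κ, by positivity, fun Ω _ P _ G μ σ ε hσ hG hlaw hK => ?_⟩
  obtain ⟨X, hX, hXG⟩ := hG.exists_isStandardSteps hσ
  rw [hlaw] at hX
  set r := ε / σ with hr
  have hKr : max c 1 ≤ κ * r := by
    have : max c 1 / κ ≤ r := (le_div_iff₀ hσ).2 hK
    rw [div_le_iff₀ hκ] at this
    linarith
  have hκr1 : 1 ≤ κ * r := (le_max_right _ _).trans hKr
  have hr0 : 0 < r := by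
    by_contra h
    nlinarith [not_lt.1 h]
  have hr1 : 1 ≤ r := by nlinarith
  have hκr : 1 ≤ κ * r ^ 2 := by nlinarith
  have hψ := hc (κ * r) ((le_max_left _ _).trans hKr)
  obtain ⟨h1, h2, h3, h4, h5⟩ := hX.moments_keysCovered hr0 hκ hκ1 hψ hκr (y := key G) (a := μ)
    (ε := ε) (by filter_upwards [hXG] with ω hω using exit_iff_lt_abs_sum hσ hω)
  have hr4 : ε ^ 4 / σ ^ 4 = r ^ 4 := by rw [hr, div_pow]
  have e5 : 5 * ε ^ 4 / (3 * σ ^ 4) = 5 / 3 * r ^ 4 := by rw [← hr4]; ring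
  have e2 : 2 * ε ^ 4 / (3 * σ ^ 4) = 2 / 3 * r ^ 4 := by rw [← hr4]; ring
  have hr4p : 0 < r ^ 4 := by positivity
  rw [hr4, e5, e2]
  have hκδ' : 200 * κ * r ^ 4 ≤ δ * r ^ 4 := by gcongr; linarith
  have hκ4 : 0 < κ * r ^ 4 := by positivity
  refine ⟨h1, h2, h5.trans (by linarith), ?_⟩
  rw [variance_eq_sub h2]
  simp only [Pi.pow_apply]
  set A := ∫ ω, ((keysCovered (key G) μ ε ω).toNat : ℝ) ∂P
  have hA1 : r ^ 4 ≤ A ^ 2 := by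
    have := pow_le_pow_left₀ (by positivity) h3 2
    linarith
  have hA2 : A ^ 2 ≤ (1 + 21 * κ) * r ^ 4 := by
    have h := pow_le_pow_left₀ ((by positivity : 0 ≤ r ^ 2).trans h3) h4 2
    have : (1 + 10 * κ) ^ 2 * r ^ 4 ≤ (1 + 21 * κ) * r ^ 4 := by gcongr; nlinarith
    linarith
  obtain ⟨h6, h7⟩ := abs_le.1 h5
  rw [abs_le]
  constructor <;> linarith

/-! ### Exit times of continuous paths through dyadic grids. -/

section Grid

variable {Ω : Type*} {X : ℝ≥0 → Ω → ℝ} {y : ℕ → ℕ → Ω → ℝ} {ε : ℝ} {ω : Ω} {n m : ℕ}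

lemma exit_iff_notMem_Icc (hy : ∀ n i : ℕ, y n i ω = X (i / 2 ^ n) ω) (n i : ℕ) :
    (y n i ω > 0 * i + ε ∨ y n i ω < 0 * i - ε) ↔ X (i / 2 ^ n) ω ∉ Set.Icc (-ε) ε := by
  rw [hy, Set.mem_Icc, not_and_or, not_le, not_le, zero_mul, zero_add, zero_sub, or_comm]

lemma exitTime_le_of_keysCovered (hy : ∀ n i : ℕ, y n i ω = X (i / 2 ^ n) ω)
    (h : keysCovered (y n) 0 ε ω ≠ ⊤) :
    exitTime X ε ω ≤
      (((keysCovered (y n) 0 ε ω).toNat / 2 ^ n : ℝ≥0) : ℝ≥0∞) := by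
  obtain ⟨m, h1, h2, -⟩ := exit_of_keysCovered_ne_top h
  rw [h1, ENat.toNat_natCast]
  exact iInf₂_le (f := fun (t : ℝ≥0) (_ : X t ω ∉ Set.Icc (-ε) ε) => (t : ℝ≥0∞)) _
    ((exit_iff_notMem_Icc hy n m).1 h2)

/-- The grids are nested: index `m` at level `n` is index `m * 2 ^ k` at level `n + k`, so
refinement can only make the exit earlier. -/
lemma keysCovered_refine (hy : ∀ n i : ℕ, y n i ω = X (i / 2 ^ n) ω)
    (h : keysCovered (y n) 0 ε ω ≠ ⊤) (k : ℕ) :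
    keysCovered (y (n + k)) 0 ε ω ≠ ⊤ ∧
      ((keysCovered (y (n + k)) 0 ε ω).toNat : ℝ) / 2 ^ (n + k) ≤
        ((keysCovered (y n) 0 ε ω).toNat : ℝ) / 2 ^ n := by
  obtain ⟨m, h1, h2, -⟩ := exit_of_keysCovered_ne_top h
  have h3 := (exit_iff_notMem_Icc hy n m).1 h2
  have e : ((m * 2 ^ k : ℕ) : ℝ≥0) / 2 ^ (n + k) = m / 2 ^ n := by
    push_cast; rw [pow_add]; field_simp
  have h4 : keysCovered (y (n + k)) 0 ε ω ≤ (m * 2 ^ k : ℕ) :=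
    keysCovered_le ((exit_iff_notMem_Icc hy (n + k) (m * 2 ^ k)).2 (e.symm ▸ h3))
  refine ⟨ne_top_of_le_ne_top (ENat.natCast_ne_top _) h4, ?_⟩
  have h5 : (keysCovered (y (n + k)) 0 ε ω).toNat ≤ m * 2 ^ k := by
    have := ENat.toNat_le_toNat h4 (ENat.natCast_ne_top _)
    rwa [ENat.toNat_natCast] at this
  rw [h1, ENat.toNat_natCast, div_le_div_iff₀ (by positivity) (by positivity)]
  calc ((keysCovered (y (n + k)) 0 ε ω).toNat : ℝ) * 2 ^ n ≤ (m * 2 ^ k : ℕ) * 2 ^ n := by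
        gcongr
    _ = m * 2 ^ (n + k) := by push_cast; ring

lemma tendsto_ceil_grid (t : ℝ≥0) :
    Tendsto (fun n : ℕ => ((⌈t * 2 ^ n⌉₊ : ℕ) : ℝ≥0) / 2 ^ n) atTop (𝓝 t) := by
  rw [← NNReal.tendsto_coe]
  refine ((tendsto_nat_ceil_mul_div_atTop (R := ℝ) t.2).comp
    (tendsto_pow_atTop_atTop_of_one_lt (one_lt_two (α := ℝ)))).congr fun n => ?_
  have : ⌈(t : ℝ) * 2 ^ n⌉₊ = ⌈t * 2 ^ n⌉₊ := 
    eq_of_forall_ge_iff fun k => by rw [Nat.ceil_le, Nat.ceil_le]; exact_mod_cast Iff.rfl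
  simp [this]

/-- The exit time of a continuous path is the limit of the exit times on the dyadic grids. -/
lemma tendsto_keysCovered_div (hy : ∀ n i : ℕ, y n i ω = X (i / 2 ^ n) ω)
    (hc : Continuous fun t => X t ω) {n₀ : ℕ} (h : keysCovered (y n₀) 0 ε ω ≠ ⊤) :
    exitTime X ε ω ≠ ⊤ ∧
      Tendsto (fun n => ((keysCovered (y n) 0 ε ω).toNat : ℝ) / 2 ^ n) atTop
        (𝓝 (exitTime X ε ω).toReal) := by
  have hτ : exitTime X ε ω ≠ ⊤ :=
    ne_top_of_le_ne_top ENNReal.coe_ne_top (exitTime_le_of_keysCovered hy h)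
  refine ⟨hτ, tendsto_order.2 ⟨fun a ha => ?_, fun a ha => ?_⟩⟩
  · filter_upwards [eventually_ge_atTop n₀] with n hn
    obtain ⟨k, rfl⟩ := Nat.exists_eq_add_of_le hn
    have h1 := ENNReal.toReal_mono ENNReal.coe_ne_top
      (exitTime_le_of_keysCovered hy (keysCovered_refine hy h k).1)
    rw [ENNReal.coe_toReal] at h1
    push_cast at h1
    exact ha.trans_le h1
  · have ha' : exitTime X ε ω < ENNReal.ofReal a := (ENNReal.lt_ofReal_iff_toReal_lt hτ).2 ha
    unfold exitTime at ha'
    simp only [iInf_lt_iff] at ha'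
    obtain ⟨t, ht, hta⟩ := ha'
    have hta' : (t : ℝ) < a := by
      have := (ENNReal.lt_ofReal_iff_toReal_lt ENNReal.coe_ne_top).1 hta
      simpa using this
    have hlim := tendsto_ceil_grid t
    -- Being outside a closed interval is an open condition along a continuous path, so grid points
    -- close to the exit instant `t` are exits too.
    have hopen : ∀ᶠ s in 𝓝 t, X s ω ∉ Set.Icc (-ε) ε :=
      hc.continuousAt.eventually (isClosed_Icc.isOpen_compl.mem_nhds ht)
    have hlt : ∀ᶠ s : ℝ≥0 in 𝓝 t, (s : ℝ) < a :=
      NNReal.continuous_coe.continuousAt.eventually (gt_mem_nhds hta')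
    filter_upwards [hlim.eventually hopen, hlim.eventually hlt] with n h1 h2
    have h3 := keysCovered_le ((exit_iff_notMem_Icc hy n _).2 h1)
    have h4 := ENat.toNat_le_toNat h3 (ENat.natCast_ne_top _)
    rw [ENat.toNat_natCast] at h4
    refine lt_of_le_of_lt ?_ h2
    push_cast
    gcongr

end Grid

/-! ### Exact moments for Brownian motion. -/

section Brownian

variable {Ω : Type*} [mΩ : MeasurableSpace Ω] {P : Measure Ω} [IsProbabilityMeasure P]
  {B : ℝ≥0 → Ω → ℝ} {σ ε : ℝ}

/-- Increments of `σ * B` over the dyadic grid of mesh `2⁻ⁿ`. -/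
noncomputable def dyadicGap (B : ℝ≥0 → Ω → ℝ) (σ : ℝ) (n i : ℕ) (ω : Ω) : ℝ :=
  σ * B ((i + 1 : ℕ) / 2 ^ n) ω - σ * B (i / 2 ^ n) ω

omit mΩ in
lemma key_dyadicGap {ω : Ω} (h0 : B 0 ω = 0) (n i : ℕ) :
    key (dyadicGap B σ n) i ω = σ * B (i / 2 ^ n) ω := by
  unfold key dyadicGap
  rw [Finset.sum_range_sub fun i : ℕ => σ * B (i / 2 ^ n) ω]
  simp [h0]

omit [IsProbabilityMeasure P] in
lemma hasLaw_dyadicGap (hB : IsBrownianReal B P) (n i : ℕ) :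
    HasLaw (dyadicGap B σ n i) (gaussianReal 0 (.mk (σ ^ 2) (sq_nonneg σ) * (2 ^ n)⁻¹)) P := by
  have h := gaussianReal_const_mul (hB.hasLaw_sub ((i + 1 : ℕ) / 2 ^ n) (i / 2 ^ n)) σ
  have e : nndist (((i + 1 : ℕ) / 2 ^ n : ℝ≥0) : ℝ) ((i / 2 ^ n : ℝ≥0) : ℝ) = (2 ^ n)⁻¹ := by
    ext
    push_cast
    rw [Real.dist_eq, ← sub_div, add_sub_cancel_left, abs_of_pos (by positivity),
      one_div]
  rw [mul_zero] at h
  convert h using 2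
  · simp [dyadicGap, mul_sub]
  · exact congrArg _ e.symm

omit [IsProbabilityMeasure P] in
lemma isGapSequence_dyadicGap (hB : IsBrownianReal B P) (n : ℕ) :
    IsGapSequence P (dyadicGap B σ n) 0 (σ / √(2 ^ n)) where
  indep := by
    have hmono : Monotone fun i : ℕ => (i / 2 ^ n : ℝ≥0) := fun i j h => by
      have : (i : ℝ≥0) ≤ j := by exact_mod_cast h
      simp only; gcongr
    refine ((hB.hasIndepIncrements.nat hmono).comp (fun _ x => σ * x)
      fun _ => by fun_prop).congr fun i => ae_of_all _ fun ω => ?_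
    simp [dyadicGap, mul_sub]
  identDistrib i := ⟨(hasLaw_dyadicGap hB n i).aemeasurable, (hasLaw_dyadicGap hB n 0).aemeasurable,
    by rw [(hasLaw_dyadicGap hB n i).map_eq, (hasLaw_dyadicGap hB n 0).map_eq]⟩
  memLp := (hasLaw_dyadicGap hB n 0).hasGaussianLaw.memLp_two
  mean := by
    have := (hasLaw_dyadicGap (σ := σ) hB n 0).integral_eq
    rwa [integral_id_gaussianReal] at this
  variance := by
    rw [(hasLaw_dyadicGap hB n 0).variance_eq, variance_id_gaussianReal, div_pow,
      Real.sq_sqrt (by positivity)]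
    rfl

omit [IsProbabilityMeasure P] in
-- The law is the same for all `n`; hence the threshold `K` of the discrete theorem does not depend
-- on the mesh.
lemma map_standardized_dyadicGap (hB : IsBrownianReal B P) (hσ : 0 < σ) (n : ℕ) :
    P.map (fun ω => (dyadicGap B σ n 0 ω - 0) / (σ / √(2 ^ n))) = gaussianReal 0 1 := by
  have h := gaussianReal_div_const (hasLaw_dyadicGap (σ := σ) hB n 0) (σ / √(2 ^ n))
  simp_rw [sub_zero]
  rw [h.map_eq, zero_div]
  congr 1
  ext
  have : (0:ℝ) < 2 ^ n := by positivity
  simp only [NNReal.coe_div, NNReal.coe_mul, NNReal.coe_mk, NNReal.coe_inv, NNReal.coe_pow,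
    NNReal.coe_one, NNReal.coe_ofNat, div_pow, Real.sq_sqrt this.le]
  field_simp

/-- The exit time of Brownian motion: exact second moment and variance. -/
theorem exitTime_second_moment_and_variance (hσ : 0 < σ) (hε : 0 < ε)
    (hB : IsBrownianReal B P) :
    (∀ᵐ ω ∂P, exitTime (fun t ω => σ * B t ω) ε ω ≠ ⊤) ∧
    MemLp (fun ω => (exitTime (fun t ω => σ * B t ω) ε ω).toReal) 2 P ∧
    (∫ ω, (exitTime (fun t ω => σ * B t ω) ε ω).toReal ^ 2 ∂P) = 5 * ε ^ 4 / (3 * σ ^ 4) ∧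
    Var[fun ω => (exitTime (fun t ω => σ * B t ω) ε ω).toReal; P] =
      2 * ε ^ 4 / (3 * σ ^ 4) := by
  set X : ℝ≥0 → Ω → ℝ := fun t ω => σ * B t ω
  set N : ℕ → Ω → ℕ∞ := fun n => keysCovered (key (dyadicGap B σ n)) 0 ε
  set Z : ℕ → Ω → ℝ := fun n ω => ((N n ω).toNat : ℝ) / 2 ^ n
  set τ : Ω → ℝ := fun ω => (exitTime X ε ω).toReal
  have hscale : Tendsto (fun n : ℕ => σ / √(2 ^ n)) atTop (𝓝 0) :=
    tendsto_const_nhds.div_atTop (Real.tendsto_sqrt_atTop.comp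
      (tendsto_pow_atTop_atTop_of_one_lt one_lt_two))
  have hpow : ∀ n : ℕ, (σ / √(2 ^ n)) ^ 4 = σ ^ 4 / (2 ^ n) ^ 2 := fun n => by
    rw [div_pow, show (√(2 ^ n)) ^ 4 = ((√(2 ^ n)) ^ 2) ^ 2 by ring, Real.sq_sqrt (by positivity)]
  -- The fourth power of the gap deviation is `σ⁴ / (2 ^ n)²`, and this factor is cancelled exactly
  -- by measuring time in units of `2⁻ⁿ`.
  have hmain : ∀ δ : ℝ, 0 < δ → ∀ᶠ n in atTop, (∀ᵐ ω ∂P, N n ω ≠ ⊤) ∧ MemLp (Z n) 2 P ∧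
      |∫ ω, Z n ω ^ 2 ∂P - 5 * ε ^ 4 / (3 * σ ^ 4)| ≤ δ * (ε ^ 4 / σ ^ 4) ∧
      |Var[Z n; P] - 2 * ε ^ 4 / (3 * σ ^ 4)| ≤ δ * (ε ^ 4 / σ ^ 4) := fun δ hδ => by
    obtain ⟨K, hK, h⟩ := keysCovered_second_moment_and_variance (gaussianReal 0 1) δ hδ
    have hev : ∀ᶠ n : ℕ in atTop, K * (σ / √(2 ^ n)) < ε := by
      have := hscale.const_mul K
      rw [mul_zero] at this
      exact this.eventually (gt_mem_nhds hε)
    filter_upwards [hev] with n hn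
    obtain ⟨h1, h2, h3, h4⟩ := h Ω P (dyadicGap B σ n) 0 (σ / √(2 ^ n)) ε (by positivity)
      (isGapSequence_dyadicGap hB n) (map_standardized_dyadicGap hB hσ n) hn.le
    have hp : (0:ℝ) < (2 ^ n) ^ 2 := by positivity
    have hZ : Z n = fun ω => (2 ^ n : ℝ)⁻¹ * ((N n ω).toNat : ℝ) := by
      ext ω; simp only [Z]; ring
    have a1 : 5 * ε ^ 4 / (3 * (σ ^ 4 / (2 ^ n) ^ 2)) =
        (2 ^ n) ^ 2 * (5 * ε ^ 4 / (3 * σ ^ 4)) := by field_simp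
    have a2 : 2 * ε ^ 4 / (3 * (σ ^ 4 / (2 ^ n) ^ 2)) =
        (2 ^ n) ^ 2 * (2 * ε ^ 4 / (3 * σ ^ 4)) := by field_simp
    have a3 : δ * (ε ^ 4 / (σ ^ 4 / (2 ^ n) ^ 2)) = (2 ^ n) ^ 2 * (δ * (ε ^ 4 / σ ^ 4)) := by
      field_simp
    have key_le : ∀ u v w : ℝ, |u - (2 ^ n) ^ 2 * v| ≤ (2 ^ n) ^ 2 * w →
        |((2 ^ n : ℝ)⁻¹) ^ 2 * u - v| ≤ w := fun u v w huv => by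
      have : ((2 ^ n : ℝ)⁻¹) ^ 2 * u - v = ((2 ^ n) ^ 2)⁻¹ * (u - (2 ^ n) ^ 2 * v) := by
        field_simp
      rw [this, abs_mul, abs_of_pos (inv_pos.2 hp), inv_mul_le_iff₀ hp]
      exact huv
    rw [hpow, a1, a3] at h3
    rw [hpow, a2, a3] at h4
    refine ⟨h1, hZ ▸ h2.const_mul _, ?_, ?_⟩
    · rw [hZ]
      simp_rw [mul_pow]
      rw [integral_const_mul]
      exact key_le _ _ _ h3
    · rw [hZ, variance_const_mul]
      exact key_le _ _ _ h4
  -- The accuracy `1` is arbitrary: only almost sure finiteness and square integrability from level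
  -- `n₀` on are needed, `Z n₀` being the dominating function.
  obtain ⟨n₀, hn₀⟩ := eventually_atTop.1 (hmain 1 one_pos)
  have hpath : ∀ᵐ ω ∂P, exitTime X ε ω ≠ ⊤ ∧ Tendsto (fun n => Z n ω) atTop (𝓝 (τ ω)) ∧
      ∀ n ≥ n₀, Z n ω ≤ Z n₀ ω := by
    filter_upwards [hB.cont, hB.eval_zero_ae_eq_zero, (hn₀ n₀ le_rfl).1] with ω hc h0 hN
    have hy : ∀ n i : ℕ, key (dyadicGap B σ n) i ω = X (i / 2 ^ n) ω := key_dyadicGap h0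
    obtain ⟨h1, h2⟩ := tendsto_keysCovered_div (y := fun n => key (dyadicGap B σ n)) hy
      (hc.const_mul σ) hN
    refine ⟨h1, h2, fun n hn => ?_⟩
    obtain ⟨k, rfl⟩ := Nat.exists_eq_add_of_le hn
    exact (keysCovered_refine (y := fun n => key (dyadicGap B σ n)) hy hN k).2
  have hZ0 : ∀ n ω, 0 ≤ Z n ω := fun n ω => by positivity
  have hL0 := (hn₀ n₀ le_rfl).2.1
  have hτm : AEStronglyMeasurable τ P :=
    aestronglyMeasurable_of_tendsto_ae atTop (f := fun n => Z (n + n₀))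
      (fun n => (hn₀ (n + n₀) (Nat.le_add_left _ _)).2.1.aestronglyMeasurable)
      (by filter_upwards [hpath] with ω hω using hω.2.1.comp (tendsto_add_atTop_nat n₀))
  have hτL : MemLp τ 2 P := hL0.mono hτm (by
    filter_upwards [hpath] with ω ⟨_, h2, h3⟩
    rw [Real.norm_of_nonneg (hZ0 _ _), Real.norm_of_nonneg ENNReal.toReal_nonneg]
    exact le_of_tendsto h2 (by filter_upwards [eventually_ge_atTop n₀] with n hn using h3 n hn))
  have t2 : Tendsto (fun n => ∫ ω, Z n ω ^ 2 ∂P) atTop (𝓝 (∫ ω, τ ω ^ 2 ∂P)) := by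
    refine tendsto_integral_filter_of_dominated_convergence (fun ω => Z n₀ ω ^ 2) ?_ ?_
      hL0.integrable_sq ?_
    · filter_upwards [eventually_ge_atTop n₀] with n hn
      exact (hn₀ n hn).2.1.aestronglyMeasurable.pow 2
    · filter_upwards [eventually_ge_atTop n₀] with n hn
      filter_upwards [hpath] with ω hω
      rw [Real.norm_of_nonneg (by positivity)]
      exact pow_le_pow_left₀ (hZ0 n ω) (hω.2.2 n hn) 2
    · filter_upwards [hpath] with ω hω using hω.2.1.pow 2
  have t1 : Tendsto (fun n => ∫ ω, Z n ω ∂P) atTop (𝓝 (∫ ω, τ ω ∂P)) := by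
    refine tendsto_integral_filter_of_dominated_convergence (Z n₀) ?_ ?_
      (hL0.integrable (by norm_num)) ?_
    · filter_upwards [eventually_ge_atTop n₀] with n hn
      exact (hn₀ n hn).2.1.aestronglyMeasurable
    · filter_upwards [eventually_ge_atTop n₀] with n hn
      filter_upwards [hpath] with ω hω
      rw [Real.norm_of_nonneg (hZ0 n ω)]
      exact hω.2.2 n hn
    · filter_upwards [hpath] with ω hω using hω.2.1
  have tv : Tendsto (fun n => Var[Z n; P]) atTop (𝓝 (Var[τ; P])) := by
    rw [variance_eq_sub hτL]
    refine (t2.sub (t1.pow 2)).congr' ?_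
    filter_upwards [eventually_ge_atTop n₀] with n hn
    rw [variance_eq_sub (hn₀ n hn).2.1]
    rfl
  have hlim : ∀ {u : ℕ → ℝ} {l v : ℝ}, Tendsto u atTop (𝓝 l) →
      (∀ δ > 0, ∀ᶠ n in atTop, |u n - v| ≤ δ * (ε ^ 4 / σ ^ 4)) → l = v := fun {u l v} hu h => by
    refine tendsto_nhds_unique hu (tendsto_iff_norm_sub_tendsto_zero.2 ?_)
    refine tendsto_order.2 ⟨fun a ha => Eventually.of_forall fun n => ha.trans_le (norm_nonneg _),
      fun a ha => ?_⟩
    filter_upwards [h (a / 2 / (ε ^ 4 / σ ^ 4)) (by positivity)] with n hn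
    rw [div_mul_cancel₀ _ (by positivity)] at hn
    rw [Real.norm_eq_abs]; linarith
  refine ⟨by filter_upwards [hpath] with ω hω using hω.1, hτL,
    hlim t2 fun δ hδ => ?_, hlim tv fun δ hδ => ?_⟩
  · filter_upwards [hmain δ hδ] with n hn using hn.2.2.1
  · filter_upwards [hmain δ hδ] with n hn using hn.2.2.2

end Brownian

end SoftFD

theorem theorem3 :
    -- Discrete model, slope equal to the mean gap, and margin much larger than `σ`: the threshold
    -- `K` depends only on the accuracy `δ` and on the law `ν` of the standardized gap.
    (∀ (ν : Measure ℝ) (δ : ℝ), 0 < δ → ∃ K : ℝ, 0 < K ∧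
      ∀ (Ω : Type*) [MeasurableSpace Ω] (P : Measure Ω) [IsProbabilityMeasure P]
        (G : ℕ → Ω → ℝ) (μ σ ε : ℝ), 0 < σ → SoftFD.IsGapSequence P G μ σ →
        P.map (fun ω => (G 0 ω - μ) / σ) = ν → K * σ ≤ ε →
        (∀ᵐ ω ∂P, SoftFD.keysCovered (SoftFD.key G) μ ε ω ≠ ⊤) ∧
        MemLp (fun ω => ((SoftFD.keysCovered (SoftFD.key G) μ ε ω).toNat : ℝ)) 2 P ∧
        |(∫ ω, ((SoftFD.keysCovered (SoftFD.key G) μ ε ω).toNat : ℝ) ^ 2 ∂P)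
            - 5 * ε ^ 4 / (3 * σ ^ 4)| ≤ δ * (ε ^ 4 / σ ^ 4) ∧
        |Var[fun ω => ((SoftFD.keysCovered (SoftFD.key G) μ ε ω).toNat : ℝ); P]
            - 2 * ε ^ 4 / (3 * σ ^ 4)| ≤ δ * (ε ^ 4 / σ ^ 4)) ∧
    -- Brownian limit model: driftless Brownian motion with diffusion rate `σ` started at `0`;
    -- the values are exact.
    (∀ (Ω : Type*) [MeasurableSpace Ω] (P : Measure Ω) [IsProbabilityMeasure P]
        (B : ℝ≥0 → Ω → ℝ) (σ ε : ℝ), 0 < σ → 0 < ε → IsBrownianReal B P →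
        (∀ᵐ ω ∂P, SoftFD.exitTime (fun t ω => σ * B t ω) ε ω ≠ ⊤) ∧
        MemLp (fun ω => (SoftFD.exitTime (fun t ω => σ * B t ω) ε ω).toReal) 2 P ∧
        (∫ ω, (SoftFD.exitTime (fun t ω => σ * B t ω) ε ω).toReal ^ 2 ∂P)
          = 5 * ε ^ 4 / (3 * σ ^ 4) ∧
        Var[fun ω => (SoftFD.exitTime (fun t ω => σ * B t ω) ε ω).toReal; P]
          = 2 * ε ^ 4 / (3 * σ ^ 4)) :=
  ⟨SoftFD.keysCovered_second_moment_and_variance, fun _ _ _ _ _ _ _ hσ hε hB =>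
    SoftFD.exitTime_second_moment_and_variance hσ hε hB⟩
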